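/- Let $(\tilde M,\tilde g,J)$ be a nearly Kaehler manifold: $\tilde g$ is a Riemannian metric with Levi-Civita connection $\tilde\nabla$, $J$ is a smooth almost complex structure with $\tilde g(JX,JY)=\tilde g(X,Y)$, and $(\tilde\nabla_XJ)Y+(\tilde\nabla_YJ)X=0$ for all vector fields $X,Y$. Let $(M_T,g_T)$, $(M_\perp,g_\perp)$, $(M_\theta,g_\theta)$ be nonempty Riemannian manifolds (all manifolds are smooth, finite-dimensional and without boundary) with $M_T$ connected and $\dim M_\perp\ge 1$, let $f_1,f_2:M_T\to(0,\infty)$ be smooth, and let $M=M_T\times_{f_1}M_\perp\times_{f_2}M_\theta$ be the bi-warped product, that is, $M_T\times M_\perp\times M_\theta$ with the metric $$g(X,Y)=g_T(\pi_{T*}X,\pi_{T*}Y)+(f_1\circ\pi_T)^2\,g_\perp(\pi_{\perp*}X,\pi_{\perp*}Y)+(f_2\circ\pi_T)^2\,g_\theta(\pi_{\theta*}X,\pi_{\theta*}Y).$$ Suppose that $M$ is an isometrically immersed submanifold of $\tilde M$ such that, as submanifolds of $\tilde M$, the leaves $M_T\times\{y\}\times\{z\}$ are holomorphic ($J$ maps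 each tangent space onto itself), the leaves $\{x\}\times M_\perp\times\{z\}$ are totally real ($J$ maps each tangent space into its orthogonal complement), and the leaves $\{x\}\times\{y\}\times M_\theta$ are proper slant with slant angle $\theta\in(0,\pi/2)$ (for every nonzero vector $X$ tangent to such a leaf, the angle between $JX$ and the tangent space of the leaf is $\theta$). Let $\mathfrak D=TM_T$ and $\mathfrak D^\perp=TM_\perp$ be the distributions on $M$ tangent to the first and the second factor, and let $h$ be the second fundamental form of $M$ in $\tilde M$. If $M$ is $\mathfrak D\oplus\mathfrak D^\perp$-mixed totally geodesic, i.e. $h(X,Z)=0$ for all $X\in\mathfrak D$ and $Z\in\mathfrak D^\perp$, then $f_1$ is a constant $c>0$. Hence $M$ is an ordinary warped product: its metric is that of $(M_T\times M'_\perp)\times_{f_2}M_\theta$, where $M'_\perp=(M_\perp,c^2g_\perp)$, $M_T\times M'_\perp$ is the Riemannian product, and $f_2$ is regarded as a function on $M_T\times M'_\perp$ through the projection to $M_T$. -/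

import Mathlib

open Bundle
open scoped Manifold ContDiff Topology

noncomputable section

/-! ## Riemannian metrics: pullbacks, products, warped and bi-warped products -/

section Metrics

set_option linter.unusedSectionVars false

variable {E₁ : Type*} [NormedAddCommGroup E₁] [NormedSpace ℝ E₁]
  {H₁ : Type*} [TopologicalSpace H₁] {I₁ : ModelWithCorners ℝ E₁ H₁}
  {M₁ : Type*} [TopologicalSpace M₁] [ChartedSpace H₁ M₁] [IsManifold I₁ ∞ M₁]
  {E₂ : Type*} [NormedAddCommGroup E₂] [NormedSpace ℝ E₂]
  {H₂ : Type*} [TopologicalSpace H₂] {I₂ : ModelWithCorners ℝ E₂ H₂}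
  {M₂ : Type*} [TopologicalSpace M₂] [ChartedSpace H₂ M₂] [IsManifold I₂ ∞ M₂]
  {E₃ : Type*} [NormedAddCommGroup E₃] [NormedSpace ℝ E₃]
  {H₃ : Type*} [TopologicalSpace H₃] {I₃ : ModelWithCorners ℝ E₃ H₃}
  {M₃ : Type*} [TopologicalSpace M₃] [ChartedSpace H₃ M₃] [IsManifold I₃ ∞ M₃]

variable (I₁ M₁) in
/-- Smooth Riemannian metrics on the manifold `M₁`. -/
abbrev SmoothMetric := ContMDiffRiemannianMetric I₁ ∞ E₁ (fun x : M₁ => TangentSpace I₁ x)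

variable (I₁ M₁) in
/-- Families of bilinear forms on the tangent spaces of `M₁`. -/
abbrev TangentForm := ∀ p : M₁, TangentSpace I₁ p →L[ℝ] TangentSpace I₁ p →L[ℝ] ℝ

/-- A family of bilinear forms on the tangent spaces is smooth if it is a smooth section. -/
def TangentForm.IsSmooth (b : TangentForm I₁ M₁) : Prop :=
  ContMDiff I₁ (I₁.prod 𝓘(ℝ, E₁ →L[ℝ] E₁ →L[ℝ] ℝ)) ∞
    (fun p => TotalSpace.mk' (E₁ →L[ℝ] E₁ →L[ℝ] ℝ)
      (E := fun p : M₁ => TangentSpace I₁ p →L[ℝ] TangentSpace I₁ p →L[ℝ] ℝ) p (b p))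

variable (I₁) in
/-- The pullback `ψ^* g`, i.e. `(v, w) ↦ g (dψ v, dψ w)`. -/
def SmoothMetric.pullbackForm (g : SmoothMetric I₂ M₂) (ψ : M₁ → M₂) : TangentForm I₁ M₁ :=
  fun p => (ContinuousLinearMap.precomp ℝ (mfderiv I₁ I₂ ψ p)) ∘L
    ((g.inner (ψ p)) ∘L (mfderiv I₁ I₂ ψ p))

lemma SmoothMetric.pullbackForm_apply (g : SmoothMetric I₂ M₂) (ψ : M₁ → M₂) (p : M₁)
    (v w : TangentSpace I₁ p) : SmoothMetric.pullbackForm I₁ g ψ p v w =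
      g.inner (ψ p) (mfderiv I₁ I₂ ψ p v) (mfderiv I₁ I₂ ψ p w) := rfl

lemma SmoothMetric.isSmooth_pullbackForm (g : SmoothMetric I₂ M₂) {ψ : M₁ → M₂}
    (hψ : ContMDiff I₁ I₂ ∞ ψ) : (SmoothMetric.pullbackForm I₁ g ψ).IsSmooth := by
  intro p₀
  rw [contMDiffAt_hom_bundle]
  refine ⟨contMDiffAt_id, ?_⟩
  have hG := ((contMDiffAt_hom_bundle _).1 (g.contMDiff (ψ p₀))).2.comp p₀ (hψ p₀)
  have hA := ContMDiffAt.mfderiv_const (m := ∞) (hψ p₀) (by simp)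
  have h1 := hG.clm_comp hA
  have h2 := (hA.clm_precomp (F₃ := ℝ)).clm_comp h1
  refine h2.congr_of_eventuallyEq ?_
  have e1 : ∀ᶠ p in 𝓝 p₀, p ∈ (trivializationAt E₁ (TangentSpace I₁) p₀).baseSet :=
    (trivializationAt E₁ (TangentSpace I₁) p₀).open_baseSet.mem_nhds
      (FiberBundle.mem_baseSet_trivializationAt' p₀)
  have e2 : ∀ᶠ p in 𝓝 p₀, ψ p ∈ (trivializationAt E₂ (TangentSpace I₂) (ψ p₀)).baseSet :=
    hψ.continuous.continuousAt <|
    (trivializationAt E₂ (TangentSpace I₂) (ψ p₀)).open_baseSet.mem_nhds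
      (FiberBundle.mem_baseSet_trivializationAt' (ψ p₀))
  filter_upwards [e1, e2] with p h1 h2
  ext v w
  have key : ∀ v : E₁, (trivializationAt E₂ (TangentSpace I₂) (ψ p₀)).symm (ψ p)
      (inTangentCoordinates I₁ I₂ id ψ (mfderiv I₁ I₂ ψ) p₀ p v) = mfderiv I₁ I₂ ψ p
        ((trivializationAt E₁ (TangentSpace I₁) p₀).symm p v) := by
    intro v
    unfold inTangentCoordinates
    simp only [id]
    rw [ContinuousLinearMap.inCoordinates_eq h1 h2]
    simp only [ContinuousLinearMap.comp_apply, ContinuousLinearEquiv.coe_coe]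
    exact ((trivializationAt E₂ (TangentSpace I₂) (ψ p₀)).continuousLinearEquivAt ℝ
      (ψ p) h2).symm_apply_apply _
  rw [inCoordinates_apply_eq₂ h1 h1 (Set.mem_univ _)]
  have := inCoordinates_apply_eq₂ (F₃ := ℝ) (E₃ := fun _ : M₂ => ℝ)
    (ϕ := g.inner (ψ p))
    (v := inTangentCoordinates I₁ I₂ id ψ (mfderiv I₁ I₂ ψ) p₀ p v)
    (w := inTangentCoordinates I₁ I₂ id ψ (mfderiv I₁ I₂ ψ) p₀ p w) h2 h2 (Set.mem_univ _)
  rw [key, key] at this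
  exact Eq.trans rfl this.symm

lemma TangentForm.IsSmooth.add {b b' : TangentForm I₁ M₁} (h : b.IsSmooth) (h' : b'.IsSmooth) :
    TangentForm.IsSmooth (fun p => b p + b' p) :=
  ContMDiff.add_section h h'

lemma TangentForm.IsSmooth.smul {a : M₁ → ℝ} {b : TangentForm I₁ M₁}
    (ha : ContMDiff I₁ 𝓘(ℝ) ∞ a) (h : b.IsSmooth) :
    TangentForm.IsSmooth (fun p => a p • b p) :=
  ContMDiff.smul_section ha h

/-- A positive definite form on a finite-dimensional space has a bounded unit ball. -/
lemma isVonNBounded_of_posDef {E : Type*} [NormedAddCommGroup E] [NormedSpace ℝ E]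
    [FiniteDimensional ℝ E] (b : E →L[ℝ] E →L[ℝ] ℝ) (hb : ∀ v, v ≠ 0 → 0 < b v v) :
    Bornology.IsVonNBounded ℝ {v : E | b v v < 1} := by
  rw [NormedSpace.isVonNBounded_iff, isBounded_iff_forall_norm_le]
  rcases (Metric.sphere (0 : E) 1).eq_empty_or_nonempty with h | h
  · refine ⟨0, fun v _ => ?_⟩
    by_contra hv
    have hv0 : v ≠ 0 := by rintro rfl; simp at hv
    have : (‖v‖⁻¹ • v) ∈ Metric.sphere (0 : E) 1 := by simp [norm_smul, hv0]
    simp [h] at this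
  · obtain ⟨u, hu, hmin⟩ := (isCompact_sphere (0 : E) 1).exists_isMinOn h
      (f := fun v => b v v)
      ((b.continuous.clm_apply continuous_id).continuousOn)
    have hu0 : u ≠ 0 := by rintro rfl; simp at hu
    have hm := hb u hu0
    set m := b u u
    refine ⟨√(m⁻¹), fun v hv => ?_⟩
    rcases eq_or_ne v 0 with rfl | hv0
    · simp
    apply Real.le_sqrt_of_sq_le
    have h1 : m ≤ b (‖v‖⁻¹ • v) (‖v‖⁻¹ • v) := hmin (by simp [norm_smul, hv0])
    have hv' : 0 < ‖v‖ := norm_pos_iff.2 hv0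
    simp only [map_smul, smul_apply, smul_eq_mul] at h1
    have h2 : m * ‖v‖ ^ 2 ≤ b v v := by
      calc m * ‖v‖ ^ 2 ≤ (‖v‖⁻¹ * (‖v‖⁻¹ * b v v)) * ‖v‖ ^ 2 := by gcongr
        _ = b v v := by field_simp
    have h3 : m * ‖v‖ ^ 2 ≤ 1 := h2.trans (le_of_lt hv)
    rw [inv_eq_one_div, le_div_iff₀ hm]; linarith

/-- The Riemannian metric given by a smooth family of positive definite symmetric forms. -/
def TangentForm.toMetric [FiniteDimensional ℝ E₁] (b : TangentForm I₁ M₁) (hs : b.IsSmooth)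
    (symm : ∀ p v w, b p v w = b p w v) (pos : ∀ p v, v ≠ 0 → 0 < b p v v) :
    SmoothMetric I₁ M₁ where
  inner := b
  symm := symm
  pos := pos
  isVonNBounded p := isVonNBounded_of_posDef (E := E₁) (b p) (pos p)
  contMDiff := hs

lemma SmoothMetric.nonneg (g : SmoothMetric I₁ M₁) (p : M₁) (v : TangentSpace I₁ p) :
    0 ≤ g.inner p v v := by
  rcases eq_or_ne v 0 with rfl | hv
  · simp
  · exact (g.pos p v hv).le

variable [FiniteDimensional ℝ E₁] [FiniteDimensional ℝ E₂] [FiniteDimensional ℝ E₃]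

/-- The rescaled metric `c² g`. -/
def SmoothMetric.scale (g : SmoothMetric I₁ M₁) (c : ℝ) (hc : 0 < c) : SmoothMetric I₁ M₁ :=
  TangentForm.toMetric (fun p => c ^ 2 • g.inner p)
    (TangentForm.IsSmooth.smul (a := fun _ => c ^ 2) contMDiff_const g.contMDiff)
    (fun p v w => by simp [g.symm p v w])
    (fun p v hv => by
      have := g.pos p v hv
      simp only [smul_apply, smul_eq_mul]
      positivity)

/-- The warped product metric on `M₁ ×_f M₂`,
`g(X, Y) = g₁(π₁_* X, π₁_* Y) + (f ∘ π₁)² g₂(π₂_* X, π₂_* Y)`. -/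
def warpedMetric (g₁ : SmoothMetric I₁ M₁) (g₂ : SmoothMetric I₂ M₂) (f : M₁ → ℝ)
    (hf : ContMDiff I₁ 𝓘(ℝ) ∞ f) (hpos : ∀ x, 0 < f x) :
    SmoothMetric (I₁.prod I₂) (M₁ × M₂) :=
  TangentForm.toMetric
    (fun p => SmoothMetric.pullbackForm (I₁.prod I₂) g₁ Prod.fst p
      + f p.1 ^ 2 • SmoothMetric.pullbackForm (I₁.prod I₂) g₂ Prod.snd p)
    (TangentForm.IsSmooth.add (SmoothMetric.isSmooth_pullbackForm g₁ contMDiff_fst)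
      (TangentForm.IsSmooth.smul ((hf.comp contMDiff_fst).pow 2)
        (SmoothMetric.isSmooth_pullbackForm g₂ contMDiff_snd)))
    (fun p v w => by
      simp only [add_apply, smul_apply,
        SmoothMetric.pullbackForm_apply]
      rw [g₁.symm, g₂.symm])
    (fun p v hv => by
      simp only [add_apply, smul_apply,
        SmoothMetric.pullbackForm_apply, smul_eq_mul, mfderiv_fst, mfderiv_snd]
      have hf := hpos p.1
      have h1 := g₁.nonneg p.1 v.1
      have h2 := g₂.nonneg p.2 v.2
      by_cases h : v.1 = 0
      · have h' : v.2 ≠ 0 := fun h' => hv (Prod.ext h h')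
        exact add_pos_of_nonneg_of_pos h1 (mul_pos (pow_pos hf 2) (g₂.pos p.2 v.2 h'))
      · exact add_pos_of_pos_of_nonneg (g₁.pos p.1 v.1 h) (mul_nonneg (by positivity) h2))

/-- The Riemannian product metric: the warped product with warping function `1`. -/
def productMetric (g₁ : SmoothMetric I₁ M₁) (g₂ : SmoothMetric I₂ M₂) :
    SmoothMetric (I₁.prod I₂) (M₁ × M₂) :=
  warpedMetric g₁ g₂ (fun _ => 1) contMDiff_const (fun _ => one_pos)

/-- The bi-warped product metric on `M₁ ×_{f₁} M₂ ×_{f₂} M₃` (with base `M₁`),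
`g(X, Y) = g₁(π₁_* X, π₁_* Y) + (f₁ ∘ π₁)² g₂(π₂_* X, π₂_* Y) + (f₂ ∘ π₁)² g₃(π₃_* X, π₃_* Y)`. -/
def biWarpedMetric (g₁ : SmoothMetric I₁ M₁) (g₂ : SmoothMetric I₂ M₂) (g₃ : SmoothMetric I₃ M₃)
    (f₁ f₂ : M₁ → ℝ) (hf₁ : ContMDiff I₁ 𝓘(ℝ) ∞ f₁) (hpos₁ : ∀ x, 0 < f₁ x)
    (hf₂ : ContMDiff I₁ 𝓘(ℝ) ∞ f₂) (hpos₂ : ∀ x, 0 < f₂ x) :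
    SmoothMetric ((I₁.prod I₂).prod I₃) ((M₁ × M₂) × M₃) :=
  TangentForm.toMetric
    (fun p => SmoothMetric.pullbackForm ((I₁.prod I₂).prod I₃) g₁ (fun q => q.1.1) p
      + f₁ p.1.1 ^ 2 • SmoothMetric.pullbackForm ((I₁.prod I₂).prod I₃) g₂ (fun q => q.1.2) p
      + f₂ p.1.1 ^ 2 • SmoothMetric.pullbackForm ((I₁.prod I₂).prod I₃) g₃ (fun q => q.2) p)
    (TangentForm.IsSmooth.add
      (TangentForm.IsSmooth.add
        (SmoothMetric.isSmooth_pullbackForm g₁ (contMDiff_fst.comp contMDiff_fst))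
        (TangentForm.IsSmooth.smul ((hf₁.comp (contMDiff_fst.comp contMDiff_fst)).pow 2)
          (SmoothMetric.isSmooth_pullbackForm g₂ (contMDiff_snd.comp contMDiff_fst))))
      (TangentForm.IsSmooth.smul ((hf₂.comp (contMDiff_fst.comp contMDiff_fst)).pow 2)
        (SmoothMetric.isSmooth_pullbackForm g₃ contMDiff_snd)))
    (fun p v w => by
      simp only [add_apply, smul_apply,
        SmoothMetric.pullbackForm_apply]
      rw [g₁.symm, g₂.symm, g₃.symm])
    (fun p v hv => by
      have d1 : mfderiv ((I₁.prod I₂).prod I₃) I₁ (fun q : (M₁ × M₂) × M₃ => q.1.1) p v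
          = v.1.1 := by
        have := mfderiv_comp p (mdifferentiableAt_fst (I := I₁) (I' := I₂) (x := p.1))
          (mdifferentiableAt_fst (I := I₁.prod I₂) (I' := I₃) (x := p))
        rw [mfderiv_fst, mfderiv_fst] at this
        exact congrArg (fun L => L v) this
      have d2 : mfderiv ((I₁.prod I₂).prod I₃) I₂ (fun q : (M₁ × M₂) × M₃ => q.1.2) p v
          = v.1.2 := by
        have := mfderiv_comp p (mdifferentiableAt_snd (I := I₁) (I' := I₂) (x := p.1))
          (mdifferentiableAt_fst (I := I₁.prod I₂) (I' := I₃) (x := p))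
        rw [mfderiv_fst, mfderiv_snd] at this
        exact congrArg (fun L => L v) this
      have d3 : mfderiv ((I₁.prod I₂).prod I₃) I₃ (fun q : (M₁ × M₂) × M₃ => q.2) p v
          = v.2 := by
        have := mfderiv_snd (I := I₁.prod I₂) (I' := I₃) (x := p)
        exact congrArg (fun L => L v) this
      simp only [add_apply, smul_apply,
        SmoothMetric.pullbackForm_apply, smul_eq_mul, d1, d2, d3]
      have hf := pow_pos (hpos₁ p.1.1) 2
      have hf' := pow_pos (hpos₂ p.1.1) 2
      have h1 := g₁.nonneg p.1.1 v.1.1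
      have h2 := mul_nonneg hf.le (g₂.nonneg p.1.2 v.1.2)
      have h3 := mul_nonneg hf'.le (g₃.nonneg p.2 v.2)
      by_cases h : v.1.1 = 0
      · by_cases h' : v.1.2 = 0
        · have h'' : v.2 ≠ 0 := fun h'' => hv (Prod.ext (Prod.ext h h') h'')
          exact add_pos_of_nonneg_of_pos (add_nonneg h1 h2) (mul_pos hf' (g₃.pos p.2 v.2 h''))
        · exact add_pos_of_pos_of_nonneg
            (add_pos_of_nonneg_of_pos h1 (mul_pos hf (g₂.pos p.1.2 v.1.2 h'))) h3
      · exact add_pos_of_pos_of_nonneg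
          (add_pos_of_pos_of_nonneg (g₁.pos p.1.1 v.1.1 h) h2) h3)

end Metrics

/-! ## Nearly Kaehler manifolds and their submanifolds -/

section Ambient

variable {E : Type*} [NormedAddCommGroup E] [NormedSpace ℝ E] [FiniteDimensional ℝ E]
  {H : Type*} [TopologicalSpace H] {I : ModelWithCorners ℝ E H}
  {N : Type*} [TopologicalSpace N] [ChartedSpace H N] [IsManifold I ∞ N]
  [RiemannianBundle (fun x : N => TangentSpace I x)]
  [IsContMDiffRiemannianBundle I ∞ E (fun x : N => TangentSpace I x)]

instance finiteDimensionalTangentSpace (x : N) : FiniteDimensional ℝ (TangentSpace I x) :=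
  inferInstanceAs (FiniteDimensional ℝ E)

/-- `D` is the Levi-Civita connection of the Riemannian manifold `N`. -/
structure IsLeviCivita (D : CovariantDerivative I E (fun x : N => TangentSpace I x)) : Prop where
  metric : @CovariantDerivative.IsMetricCompatible E _ _ H _ I N _ _ E _ _
    (fun x : N => TangentSpace I x) _ (fun _ => inferInstance) (fun _ => inferInstance) _ D _
    inferInstance inferInstance _
  torsion_free : D.torsion = 0

/-- `J` is a smooth almost complex structure on `N` for which the metric is Hermitian. -/
structure IsAlmostHermitian (J : ∀ x : N, TangentSpace I x →L[ℝ] TangentSpace I x) : Prop where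
  smooth : ContMDiff I (I.prod 𝓘(ℝ, E →L[ℝ] E)) ∞
    (fun x => TotalSpace.mk' (E →L[ℝ] E)
      (E := fun x : N => TangentSpace I x →L[ℝ] TangentSpace I x) x (J x))
  sq : ∀ x v, J x (J x v) = -v
  isometry : ∀ x v w, inner ℝ (J x v) (J x w) = inner ℝ v w

/-- The covariant derivative of the endomorphism field `J`: at `x`,
`(∇_X J) Y = ∇_X (J Y) - J (∇_X Y)`. -/
def covDerivEndo (D : CovariantDerivative I E (fun x : N => TangentSpace I x))
    (J : ∀ x : N, TangentSpace I x →L[ℝ] TangentSpace I x)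
    (X Y : ∀ x : N, TangentSpace I x) (x : N) : TangentSpace I x :=
  D (fun y => J y (Y y)) x (X x) - J x (D Y x (X x))

/-- `(N, g, J)` is nearly Kaehler: it is almost Hermitian and
`(∇_X J) Y + (∇_Y J) X = 0` for all vector fields, `∇` being the Levi-Civita connection. -/
structure IsNearlyKaehler (D : CovariantDerivative I E (fun x : N => TangentSpace I x))
    (J : ∀ x : N, TangentSpace I x →L[ℝ] TangentSpace I x) : Prop where
  leviCivita : IsLeviCivita D
  almostHermitian : IsAlmostHermitian J
  nearly : ∀ (X Y : ∀ x : N, TangentSpace I x) (x : N), MDiffAt (T% X) x → MDiffAt (T% Y) x →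
    covDerivEndo D J X Y x + covDerivEndo D J Y X x = 0

variable {E' : Type*} [NormedAddCommGroup E'] [NormedSpace ℝ E'] [FiniteDimensional ℝ E']
  {H' : Type*} [TopologicalSpace H'] {I' : ModelWithCorners ℝ E' H'}
  {M : Type*} [TopologicalSpace M] [ChartedSpace H' M] [IsManifold I' ∞ M]

/-- `φ` realizes the Riemannian manifold `(M, g)` as an (immersed) submanifold of `N` with the
induced metric. -/
structure IsIsometricImmersion (g : SmoothMetric I' M) (φ : M → N) : Prop where
  smooth : ContMDiff I' I ∞ φ
  isometric : ∀ p v w, inner ℝ (mfderiv I' I φ p v) (mfderiv I' I φ p w) = g.inner p v w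

/-- The tangent space of the submanifold `φ : M → N` at `p`, as a subspace of `T_{φ p} N`. -/
def tangentImage (I' : ModelWithCorners ℝ E' H') (I : ModelWithCorners ℝ E H)
    {M N : Type*} [TopologicalSpace M] [ChartedSpace H' M] [TopologicalSpace N] [ChartedSpace H N]
    (φ : M → N) (p : M) : Submodule ℝ (TangentSpace I (φ p)) :=
  LinearMap.range (mfderiv I' I φ p).toLinearMap

variable (I') in
/-- The submanifold `φ : M → N` is holomorphic: `J (T_p M) = T_p M` for every `p`. -/
def IsHolomorphicSubmanifold (J : ∀ x : N, TangentSpace I x →L[ℝ] TangentSpace I x)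
    (φ : M → N) : Prop :=
  ∀ p, (tangentImage I' I φ p).map (J (φ p)).toLinearMap = tangentImage I' I φ p

variable (I') in
/-- The submanifold `φ : M → N` is totally real: `J (T_p M) ⊆ T_p^⊥ M` for every `p`. -/
def IsTotallyRealSubmanifold (J : ∀ x : N, TangentSpace I x →L[ℝ] TangentSpace I x)
    (φ : M → N) : Prop :=
  ∀ p, (tangentImage I' I φ p).map (J (φ p)).toLinearMap ≤ (tangentImage I' I φ p)ᗮ

variable (I') in
/-- The submanifold `φ : M → N` is slant with slant angle `θ`: the Wirtinger angle, i.e. the angle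
between `J X` and `T_p M` (between `J X` and its tangential component; it is `π / 2` if that
component vanishes), is `θ` for all `p` and all nonzero `X ∈ T_p M`. -/
def IsSlantSubmanifold (J : ∀ x : N, TangentSpace I x →L[ℝ] TangentSpace I x)
    (φ : M → N) (θ : ℝ) : Prop :=
  ∀ p, ∀ X ∈ tangentImage I' I φ p, X ≠ 0 →
    InnerProductGeometry.angle (J (φ p) X) ((tangentImage I' I φ p).starProjection (J (φ p) X)) = θ

/-- The covariant derivative `∇_v V` of a vector field `V` along `φ : M → N` (the pullback of the
connection `D` by `φ`). In the local trivialization of `TN` around `φ p`, with local frame `E_i`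
constant in that trivialization and `V = ∑ V^i (E_i ∘ φ)`, it is the usual expression
`∑ dV^i(v) E_i + ∑ V^i ∇_{dφ v} E_i`; note that `∑ V^i(p) E_i` is `FiberBundle.extend E (V p)`. -/
def covDerivAlong (D : CovariantDerivative I E (fun x : N => TangentSpace I x)) (φ : M → N)
    (V : ∀ q : M, TangentSpace I (φ q)) (p : M) (v : TangentSpace I' p) : TangentSpace I (φ p) :=
  (trivializationAt E (TangentSpace I) (φ p)).symm (φ p)
      (mvfderiv I' (fun q => (trivializationAt E (TangentSpace I) (φ p) ⟨φ q, V q⟩).2) p v)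
    + D (FiberBundle.extend E (V p)) (φ p) (mfderiv I' I φ p v)

/-- The second fundamental form of the submanifold `φ : M → N`: by the Gauss formula, `h(v, w)` is
the component normal to `M` of the ambient covariant derivative `∇_v W`, where `W` is any vector
field on `M` extending `w`. -/
def secondFundamentalForm (D : CovariantDerivative I E (fun x : N => TangentSpace I x))
    (φ : M → N) (p : M) (v w : TangentSpace I' p) : TangentSpace I (φ p) :=
  (tangentImage I' I φ p)ᗮ.starProjection
    (covDerivAlong D φ (fun q => mfderiv I' I φ q (FiberBundle.extend E' w q)) p v)

end Ambient

end

/-! ### Derivatives of vector-valued functions on manifolds -/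

section VectorValued

variable {E : Type*} [NormedAddCommGroup E] [NormedSpace ℝ E]
  {H : Type*} [TopologicalSpace H] {I : ModelWithCorners ℝ E H}
  {M : Type*} [TopologicalSpace M] [ChartedSpace H M]
  {F : Type*} [NormedAddCommGroup F] [NormedSpace ℝ F]
  {G : Type*} [NormedAddCommGroup G] [NormedSpace ℝ G]

/-! Write ∇ for the Levi-Civita connection of the ambient manifold, pulled back along the immersion
φ. Take A tangent to the first factor and Z nonzero and tangent to the second, both extended as
coordinate fields. The Koszul formula (`IsLeviCivita.koszul_along`) gives 2⟨∇_Z Z, A⟩ = -A⟨Z, Z⟩,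
because ⟨Z, A⟩ = 0 identically, and in the bi-warped metric A⟨Z, Z⟩ = 2 f₁ (A f₁) g_⊥(Z, Z). So A f₁
= 0 as soon as ⟨∇_Z Z, A⟩ = 0.

Let B be the vector of the first factor with dφ B = J dφ A. Since J preserves the first factor, ⟨JZ,
B⟩ = 0 near the point; differentiating along Z gives 0 = ⟨∇_Z (JZ), JA⟩ + ⟨JZ, ∇_Z B⟩. The nearly
Kaehler condition with both arguments equal to Z says (∇_Z J) Z = 0, so the first term is ⟨J ∇_Z Z,
JA⟩ = ⟨∇_Z Z, A⟩. In the second term ∇_Z B = ∇_B Z, as coordinate fields commute and torsion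
vanishes. Mixed total geodesy makes this vector tangent to M, and Koszul removes its component along
the third factor (`exists_covDerivAlong_eq_mfderiv`). What remains lies in the first two factors,
and JZ is orthogonal to both: to the first by holomorphy, to the second by total reality. Hence ⟨∇_Z
Z, A⟩ = 0 (`mvfderiv_warping_eq_zero`), and connectedness makes f₁ constant.

Most of the file supplies calculus along φ: metric compatibility, the Leibniz rule for J, and
symmetry of ∇ on coordinate fields. -/

lemma Filter.EventuallyEq.mvfderiv_eq {f g : M → F} {x : M} (h : f =ᶠ[𝓝 x] g) :
    mvfderiv I f x = mvfderiv I g x := by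
  ext v
  exact congrArg (fun L : E →L[ℝ] F => L v) (h.mfderiv_eq (I := I) (I' := 𝓘(ℝ, F)))

lemma mvfderiv_eq_zero_of_eventuallyEq_const {f : M → F} {x : M} {c : F}
    (h : ∀ᶠ y in 𝓝 x, f y = c) : mvfderiv I f x = 0 := by
  have h' : f =ᶠ[𝓝 x] fun _ => c := h
  rw [h'.mvfderiv_eq, mvfderiv_const]

lemma mvfderiv_clm_apply_apply {A : M → F →L[ℝ] G} {a : M → F} {x : M}
    (hA : MDifferentiableAt I 𝓘(ℝ, F →L[ℝ] G) A x) (ha : MDifferentiableAt I 𝓘(ℝ, F) a x)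
    (v : TangentSpace I x) :
    mvfderiv I (fun y => A y (a y)) x v = mvfderiv I A x v (a x) + A x (mvfderiv I a x v) := by
  have h1 := hA.hasMFDerivAt.2.clm_apply ha.hasMFDerivAt.2
  have h2 : HasMFDerivAt I 𝓘(ℝ, G) (fun y => A y (a y)) x _ :=
    ⟨(hA.continuousAt.clm_apply ha.continuousAt), h1⟩
  have h3 := congrArg (fun L : E →L[ℝ] G => L v) h2.mfderiv
  refine h3.trans ?_
  -- The derivative comes out in terms of chart expressions, whose base point is `x` after a round
  -- trip through the chart.
  have hx : (extChartAt I x).symm (extChartAt I x x) = x := extChartAt_to_inv x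
  simp only [writtenInExtChartAt, Function.comp_apply, extChartAt_model_space_eq_id,
    PartialEquiv.refl_coe, id_eq, hx]
  exact add_comm _ _

lemma mvfderiv_clm_apply₂_apply {K : Type*} [NormedAddCommGroup K] [NormedSpace ℝ K]
    {A : M → F →L[ℝ] G →L[ℝ] K} {a : M → F} {b : M → G} {x : M}
    (hA : MDifferentiableAt I 𝓘(ℝ, F →L[ℝ] G →L[ℝ] K) A x)
    (ha : MDifferentiableAt I 𝓘(ℝ, F) a x) (hb : MDifferentiableAt I 𝓘(ℝ, G) b x)
    (v : TangentSpace I x) :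
    mvfderiv I (fun y => A y (a y) (b y)) x v = mvfderiv I A x v (a x) (b x)
      + A x (mvfderiv I a x v) (b x) + A x (a x) (mvfderiv I b x v) := by
  rw [mvfderiv_clm_apply_apply (hA.clm_apply ha) hb, mvfderiv_clm_apply_apply hA ha, add_apply]

lemma mvfderiv_comp_eq {E' : Type*} [NormedAddCommGroup E'] [NormedSpace ℝ E']
    {H' : Type*} [TopologicalSpace H'] {I' : ModelWithCorners ℝ E' H'}
    {M' : Type*} [TopologicalSpace M'] [ChartedSpace H' M'] {f : M' → F} {ψ : M → M'} {x : M}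
    (hf : MDifferentiableAt I' 𝓘(ℝ, F) f (ψ x)) (hψ : MDifferentiableAt I I' ψ x)
    (v : TangentSpace I x) :
    mvfderiv I (fun y => f (ψ y)) x v = mvfderiv I' f (ψ x) (mfderiv I I' ψ x v) :=
  mfderiv_comp_apply x hf hψ v

end VectorValued

/-! ### Metric compatibility along a map -/

section AlongMap

variable {E : Type*} [NormedAddCommGroup E] [NormedSpace ℝ E]
  {H : Type*} [TopologicalSpace H] {I : ModelWithCorners ℝ E H}
  {N : Type*} [TopologicalSpace N] [ChartedSpace H N] [IsManifold I ∞ N]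

/-- `FiberBundle.extend` is constant in the trivialization centred at `x`. Its coordinates therefore
contribute no derivative, which isolates the connection term in the computations below. -/
lemma TangentBundle.eventually_trivializationAt_extend {x : N} (v : TangentSpace I x) :
    ∀ᶠ y in 𝓝 x, (trivializationAt E (TangentSpace I) x ⟨y, FiberBundle.extend E v y⟩).2 =
      (trivializationAt E (TangentSpace I) x ⟨x, v⟩).2 := by
  filter_upwards [(trivializationAt E (TangentSpace I) x).open_baseSet.mem_nhds
    (FiberBundle.mem_baseSet_trivializationAt' x)] with y hy
  simp only [FiberBundle.extend]
  rw [Trivialization.mk_symm _ hy, Trivialization.apply_symm_apply]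
  rwa [Trivialization.mem_target]

variable [FiniteDimensional ℝ E]

/-- A section agrees with its constant extension up to the derivative of its coordinates. -/
lemma CovariantDerivative.eq_add_extend
    (D : CovariantDerivative I E (fun x : N => TangentSpace I x))
    {σ : ∀ x : N, TangentSpace I x} {x : N} (hσ : MDiffAt (T% σ) x) (w : TangentSpace I x) :
    D σ x w = (trivializationAt E (TangentSpace I) x).symmL ℝ x
        (mvfderiv I (fun y => (trivializationAt E (TangentSpace I) x ⟨y, σ y⟩).2) x w)
      + D (FiberBundle.extend E (σ x)) x w := by
  set e := trivializationAt E (TangentSpace I : N → Type _) x with he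
  have hx : x ∈ e.baseSet := FiberBundle.mem_baseSet_trivializationAt' x
  have hx' : ∀ᶠ y in 𝓝 x, y ∈ e.baseSet := e.open_baseSet.mem_nhds hx
  have hd : ∀ {τ : ∀ x : N, TangentSpace I x}, MDiffAt (T% τ) x →
      MDiffAt (fun y => (e ⟨y, τ y⟩).2) x := fun h => (mdifferentiableAt_section _ _).1 h
  -- The difference between `D` and the flat derivative in the trivialization: the two Leibniz terms
  -- cancel, so it is tensorial and depends only on `σ x`.
  let Φ : (∀ x : N, TangentSpace I x) → TangentSpace I x := fun τ =>
    D τ x w - e.symmL ℝ x (mvfderiv I (fun y => (e ⟨y, τ y⟩).2) x w)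
  have hΦ : TensorialAt I E Φ x := by
    refine ⟨fun {f τ} hf hτ => ?_, fun {τ τ'} hτ hτ' => ?_⟩
    · have h1 : mvfderiv I (fun y => (e ⟨y, (f • τ) y⟩).2) x
          = mvfderiv I (fun y => f y • (e ⟨y, τ y⟩).2) x := by
        apply Filter.EventuallyEq.mvfderiv_eq
        filter_upwards [hx'] with y hy
        exact (e.linear ℝ hy).2 (f y) (τ y)
      have h2 := mvfderiv_fun_smul hf (hd hτ)
      have h3 : e.symmL ℝ x (e ⟨x, τ x⟩).2 = τ x := by
        rw [Trivialization.symmL_apply _ hx]; exact e.symm_apply_apply_mk hx _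
      simp only [Φ]
      rw [h1, h2, D.isCovariantDerivativeOnUniv.leibniz hτ hf]
      simp only [add_apply, smul_apply,
        ContinuousLinearMap.smulRight_apply, map_add, map_smul, h3, smul_sub]
      abel
    · have h1 : mvfderiv I (fun y => (e ⟨y, (τ + τ') y⟩).2) x
          = mvfderiv I (fun y => (e ⟨y, τ y⟩).2 + (e ⟨y, τ' y⟩).2) x := by
        apply Filter.EventuallyEq.mvfderiv_eq
        filter_upwards [hx'] with y hy
        exact (e.linear ℝ hy).1 (τ y) (τ' y)
      have h2 := mvfderiv_fun_add (hd hτ) (hd hτ')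
      simp only [Φ]
      rw [h1, h2, D.isCovariantDerivativeOnUniv.add hτ hτ']
      simp only [add_apply, map_add]
      abel
  have hext := hΦ.pointwise hσ (FiberBundle.mdifferentiableAt_extend I E (σ x))
    (FiberBundle.extend_apply_self E _).symm
  have h0 : mvfderiv I (fun y => (e ⟨y, FiberBundle.extend E (σ x) y⟩).2) x = 0 :=
    mvfderiv_eq_zero_of_eventuallyEq_const
      (TangentBundle.eventually_trivializationAt_extend (σ x))
  simp only [Φ] at hext
  rw [h0, zero_apply, map_zero, sub_zero] at hext
  rw [← hext]; abel

variable [RiemannianBundle (fun x : N => TangentSpace I x)]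
  [IsContMDiffRiemannianBundle I ∞ E (fun x : N => TangentSpace I x)]
  {E' : Type*} [NormedAddCommGroup E'] [NormedSpace ℝ E']
  {H' : Type*} [TopologicalSpace H'] {I' : ModelWithCorners ℝ E' H'}
  {M : Type*} [TopologicalSpace M] [ChartedSpace H' M]

/-- Metric compatibility for vector fields along a map. -/
lemma IsLeviCivita.mvfderiv_inner_along
    {D : CovariantDerivative I E (fun x : N => TangentSpace I x)} (hD : IsLeviCivita D)
    {φ : M → N} {V W : ∀ q, TangentSpace I (φ q)} {p : M}
    (hV : MDifferentiableAt I' I.tangent (fun q => (⟨φ q, V q⟩ : TangentBundle I N)) p)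
    (hW : MDifferentiableAt I' I.tangent (fun q => (⟨φ q, W q⟩ : TangentBundle I N)) p)
    (v : TangentSpace I' p) :
    mvfderiv I' (fun q => (inner ℝ (V q) (W q) : ℝ)) p v =
      inner ℝ (covDerivAlong D φ V p v) (W p) + inner ℝ (V p) (covDerivAlong D φ W p v) := by
  set e := trivializationAt E (TangentSpace I : N → Type _) (φ p) with he
  have hx : φ p ∈ e.baseSet := FiberBundle.mem_baseSet_trivializationAt' (φ p)
  have hx' : ∀ᶠ y in 𝓝 (φ p), y ∈ e.baseSet := e.open_baseSet.mem_nhds hx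
  rw [mdifferentiableAt_totalSpace] at hV hW
  obtain ⟨hφ, hV⟩ := hV
  obtain ⟨-, hW⟩ := hW
  change MDifferentiableAt I' I φ p at hφ
  obtain ⟨g, hg, hginner⟩ := IsContMDiffRiemannianBundle.exists_contMDiff (IB := I) (n := ∞)
    (F := E) (E := fun x : N => TangentSpace I x)
  -- The Gram form of the metric in the trivialization; the product rule for `G`, `V` and `W` in
  -- coordinates then applies.
  let G : N → E →L[ℝ] E →L[ℝ] ℝ := fun y => ContinuousLinearMap.inCoordinates E
    (fun x : N => TangentSpace I x) (E →L[ℝ] ℝ) (fun x : N => TangentSpace I x →L[ℝ] ℝ)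
    (φ p) y (φ p) y (g y)
  have hG : MDifferentiableAt I 𝓘(ℝ, E →L[ℝ] E →L[ℝ] ℝ) G (φ p) :=
    ((contMDiffAt_hom_bundle _).1 (hg (φ p))).2.mdifferentiableAt (by simp)
  have hGe : ∀ {y}, y ∈ e.baseSet → ∀ a b : E, G y a b = inner ℝ (e.symm y a) (e.symm y b) := by
    intro y hy a b
    have := inCoordinates_apply_eq₂ (F₃ := ℝ) (E₃ := fun _ : N => ℝ)
      (ϕ := g y) (v := a) (w := b) hy hy (Set.mem_univ _)
    rw [hginner]
    exact this.trans (by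
      rw [Trivialization.linearMapAt_apply]; exact if_pos (Set.mem_univ _))
  have hemk : ∀ {y} (_ : y ∈ e.baseSet) (v : TangentSpace I y), e.symm y (e ⟨y, v⟩).2 = v :=
    fun hy v => e.symm_apply_apply_mk hy v
  have h1 : mvfderiv I' (fun q => (inner ℝ (V q) (W q) : ℝ)) p =
      mvfderiv I' (fun q => G (φ q) (e ⟨φ q, V q⟩).2 (e ⟨φ q, W q⟩).2) p := by
    apply Filter.EventuallyEq.mvfderiv_eq
    filter_upwards [hφ.continuousAt hx'] with q hq
    rw [hGe hq, hemk hq, hemk hq]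
  have hGφ := hG.comp p hφ
  have h2 := mvfderiv_clm_apply₂_apply hGφ hV hW v
  have h4 : mvfderiv I' (fun q => G (φ q)) p v = mvfderiv I G (φ p) (mfderiv I' I φ p v) :=
    mvfderiv_comp_eq hG hφ v
  have h5 : mvfderiv I (fun y => (inner ℝ (FiberBundle.extend E (V p) y : TangentSpace I y)
      (FiberBundle.extend E (W p) y) : ℝ)) (φ p) =
      mvfderiv I (fun y => G y (e ⟨φ p, V p⟩).2 (e ⟨φ p, W p⟩).2) (φ p) := by
    apply Filter.EventuallyEq.mvfderiv_eq
    filter_upwards [hx'] with y hy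
    rw [hGe hy]; rfl
  -- With constant coordinates only the derivative of `G` survives, and metric compatibility on `N`
  -- evaluates it through the connection terms.
  have h6 := mvfderiv_clm_apply₂_apply hG
    (mdifferentiableAt_const (I := I) (I' := 𝓘(ℝ, E)) (x := φ p) (c := (e ⟨φ p, V p⟩).2))
    (mdifferentiableAt_const (I := I) (I' := 𝓘(ℝ, E)) (x := φ p) (c := (e ⟨φ p, W p⟩).2))
    (mfderiv I' I φ p v)
  have h8 := hD.metric.mvfderiv_inner_eq
    (fun y => (FiberBundle.extend E (mfderiv I' I φ p v) y : TangentSpace I y))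
    (FiberBundle.mdifferentiableAt_extend I E (V p))
    (FiberBundle.mdifferentiableAt_extend I E (W p))
  rw [h5] at h8
  simp only [FiberBundle.extend_apply_self] at h8
  rw [h6, mvfderiv_const, mvfderiv_const, zero_apply, map_zero, map_zero] at h8
  simp only [zero_apply, add_zero] at h8
  rw [h1]
  refine h2.trans ?_
  have h4' : mvfderiv I' (G ∘ φ) p v = mvfderiv I G (φ p) (mfderiv I' I φ p v) := h4
  rw [h4', h8]
  simp only [Function.comp_apply]
  rw [hGe hx, hGe hx, hemk hx, hemk hx]
  simp only [covDerivAlong, inner_add_left, inner_add_right]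
  ring

end AlongMap

/-! ### The Leibniz rule for `J` along a map -/

section Endomorphism

variable {E : Type*} [NormedAddCommGroup E] [NormedSpace ℝ E]
  {H : Type*} [TopologicalSpace H] {I : ModelWithCorners ℝ E H}
  {N : Type*} [TopologicalSpace N] [ChartedSpace H N] [IsManifold I ∞ N]
  {E' : Type*} [NormedAddCommGroup E'] [NormedSpace ℝ E']
  {H' : Type*} [TopologicalSpace H'] {I' : ModelWithCorners ℝ E' H'}
  {M : Type*} [TopologicalSpace M] [ChartedSpace H' M]
  {J : ∀ x : N, TangentSpace I x →L[ℝ] TangentSpace I x}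

lemma MDifferentiableAt.endo_along
    (hJ : ContMDiff I (I.prod 𝓘(ℝ, E →L[ℝ] E)) ∞ (fun x => TotalSpace.mk' (E →L[ℝ] E)
      (E := fun x : N => TangentSpace I x →L[ℝ] TangentSpace I x) x (J x)))
    {φ : M → N} {V : ∀ q, TangentSpace I (φ q)} {p : M}
    (hV : MDifferentiableAt I' I.tangent (fun q => (⟨φ q, V q⟩ : TangentBundle I N)) p) :
    MDifferentiableAt I' I.tangent
      (fun q => (⟨φ q, J (φ q) (V q)⟩ : TangentBundle I N)) p := by
  have hφ := ((mdifferentiableAt_totalSpace _ _).1 hV).1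
  have hJ' := ((contMDiffAt_hom_bundle _).1 (hJ (φ p))).2.mdifferentiableAt (by simp)
  exact MDifferentiableAt.clm_apply_of_inCoordinates (hJ'.comp p hφ) hV hφ

variable [FiniteDimensional ℝ E]

/-- The Leibniz rule for an endomorphism field applied to a vector field along a map. -/
lemma covDerivAlong_endo (D : CovariantDerivative I E (fun x : N => TangentSpace I x))
    (hJ : ContMDiff I (I.prod 𝓘(ℝ, E →L[ℝ] E)) ∞ (fun x => TotalSpace.mk' (E →L[ℝ] E)
      (E := fun x : N => TangentSpace I x →L[ℝ] TangentSpace I x) x (J x)))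
    {φ : M → N} {V : ∀ q, TangentSpace I (φ q)} {p : M}
    (hV : MDifferentiableAt I' I.tangent (fun q => (⟨φ q, V q⟩ : TangentBundle I N)) p)
    (v : TangentSpace I' p) :
    covDerivAlong D φ (fun q => J (φ q) (V q)) p v =
      covDerivEndo D J (FiberBundle.extend E (mfderiv I' I φ p v)) (FiberBundle.extend E (V p))
        (φ p) + J (φ p) (covDerivAlong D φ V p v) := by
  set e := trivializationAt E (TangentSpace I : N → Type _) (φ p) with he
  have hx : φ p ∈ e.baseSet := FiberBundle.mem_baseSet_trivializationAt' (φ p)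
  have hx' : ∀ᶠ y in 𝓝 (φ p), y ∈ e.baseSet := e.open_baseSet.mem_nhds hx
  rw [mdifferentiableAt_totalSpace] at hV
  obtain ⟨hφ, hV⟩ := hV
  change MDifferentiableAt I' I φ p at hφ
  -- The matrix of `J` in the trivialization. Its derivative is identified below by applying the
  -- coordinate formula for `D` to `J` of a constant extension.
  let A : N → E →L[ℝ] E := fun y => ContinuousLinearMap.inCoordinates E
    (fun x : N => TangentSpace I x) E (fun x : N => TangentSpace I x) (φ p) y (φ p) y (J y)
  have hA : MDifferentiableAt I 𝓘(ℝ, E →L[ℝ] E) A (φ p) :=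
    ((contMDiffAt_hom_bundle _).1 (hJ (φ p))).2.mdifferentiableAt (by simp)
  have hAe : ∀ {y}, y ∈ e.baseSet → ∀ a : E, A y a = (e ⟨y, J y (e.symm y a)⟩).2 := by
    intro y hy a
    simp only [A]
    rw [ContinuousLinearMap.inCoordinates_eq hy hy]
    rfl
  have hemk : ∀ {y} (_ : y ∈ e.baseSet) (v : TangentSpace I y), e.symm y (e ⟨y, v⟩).2 = v :=
    fun hy v => e.symm_apply_apply_mk hy v
  have h1 : mvfderiv I' (fun q => (e ⟨φ q, J (φ q) (V q)⟩).2) p =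
      mvfderiv I' (fun q => A (φ q) (e ⟨φ q, V q⟩).2) p := by
    apply Filter.EventuallyEq.mvfderiv_eq
    filter_upwards [hφ.continuousAt hx'] with q hq
    rw [hAe hq, hemk hq]
  have h2 := mvfderiv_clm_apply_apply (hA.comp p hφ) hV v
  have h4 : mvfderiv I' (fun q => A (φ q)) p v = mvfderiv I A (φ p) (mfderiv I' I φ p v) :=
    mvfderiv_comp_eq hA hφ v
  have h5 : mvfderiv I (fun y => (e ⟨y, J y (FiberBundle.extend E (V p) y)⟩).2) (φ p) =
      mvfderiv I (fun y => A y (e ⟨φ p, V p⟩).2) (φ p) := by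
    apply Filter.EventuallyEq.mvfderiv_eq
    filter_upwards [hx'] with y hy
    rw [hAe hy]; rfl
  have h6 := mvfderiv_clm_apply_apply hA
    (mdifferentiableAt_const (I := I) (I' := 𝓘(ℝ, E)) (x := φ p) (c := (e ⟨φ p, V p⟩).2))
    (mfderiv I' I φ p v)
  have h7 : D (fun y => J y (FiberBundle.extend E (V p) y)) (φ p) (mfderiv I' I φ p v) =
      e.symmL ℝ (φ p) (mvfderiv I (fun y => (e ⟨y, J y (FiberBundle.extend E (V p) y)⟩).2) (φ p)
        (mfderiv I' I φ p v)) +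
      D (FiberBundle.extend E (J (φ p) (FiberBundle.extend E (V p) (φ p)))) (φ p)
        (mfderiv I' I φ p v) :=
    D.eq_add_extend (σ := fun y => J y (FiberBundle.extend E (V p) y)) (x := φ p)
      (MDifferentiableAt.endo_along (I' := I) (φ := id) hJ
        (FiberBundle.mdifferentiableAt_extend I E (V p))) (mfderiv I' I φ p v)
  have hc : ∀ W : ∀ q, TangentSpace I (φ q), covDerivAlong D φ W p v =
      e.symmL ℝ (φ p) (mvfderiv I' (fun q => (e ⟨φ q, W q⟩).2) p v) +
        D (FiberBundle.extend E (W p)) (φ p) (mfderiv I' I φ p v) := fun W => by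
    rw [e.symmL_apply hx]; rfl
  rw [h5, h6, mvfderiv_const, zero_apply, map_zero, add_zero] at h7
  simp only [covDerivEndo, FiberBundle.extend_apply_self] at h7 ⊢
  rw [h7, hc, hc, h1]
  have h8 : mvfderiv I' (fun q => A (φ q) (e ⟨φ q, V q⟩).2) p v =
    mvfderiv I A (φ p) (mfderiv I' I φ p v) (e ⟨φ p, V p⟩).2 +
      A (φ p) (mvfderiv I' (fun q => (e ⟨φ q, V q⟩).2) p v) := by
    rw [← h4]; exact h2
  have h9 : ∀ a, e.symmL ℝ (φ p) (A (φ p) a) = J (φ p) (e.symmL ℝ (φ p) a) := by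
    intro a
    rw [hAe hx, e.symmL_apply hx, e.symmL_apply hx, hemk hx]
  rw [h8, map_add, h9, map_add]
  abel

end Endomorphism

/-! ### Coordinate fields and symmetry of covariant differentiation -/

section Coordinate

open VectorField

variable {E : Type*} [NormedAddCommGroup E] [NormedSpace ℝ E]
  {H : Type*} [TopologicalSpace H] {I : ModelWithCorners ℝ E H}
  {N : Type*} [TopologicalSpace N] [ChartedSpace H N] [IsManifold I ∞ N]

/-- Constant extensions of tangent vectors are coordinate fields, hence commute. -/
lemma VectorField.mlieBracket_extend {x : N} (a b : TangentSpace I x) :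
    mlieBracket I (FiberBundle.extend E a) (FiberBundle.extend E b) x = 0 := by
  -- In the chart at `x` the extension becomes a constant vector field on the model space.
  have key : ∀ a : TangentSpace I x, ∀ᶠ z in 𝓝[Set.range I] (extChartAt I x x),
      mpullbackWithin 𝓘(ℝ, E) I (extChartAt I x).symm (FiberBundle.extend E a) (Set.range I) z
        = (trivializationAt E (TangentSpace I) x ⟨x, a⟩).2 := by
    intro a
    filter_upwards [extChartAt_target_mem_nhdsWithin x] with z hz
    have hs : (extChartAt I x).symm z ∈ (chartAt H x).source := by
      rw [← extChartAt_source I]; exact (extChartAt I x).map_target hz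
    rw [mpullbackWithin_apply]
    have h1 := TangentBundle.symmL_trivializationAt (I := I) hs
    rw [(extChartAt I x).right_inv hz] at h1
    have h2 : FiberBundle.extend E a ((extChartAt I x).symm z) =
        mfderivWithin 𝓘(ℝ, E) I (extChartAt I x).symm (Set.range I) z
          (trivializationAt E (TangentSpace I) x ⟨x, a⟩).2 := by
      have h3 := congrArg (fun L => L (trivializationAt E (TangentSpace I) x ⟨x, a⟩).2) h1
      refine Eq.trans ?_ h3
      exact ((trivializationAt E (TangentSpace I) x).symmL_apply hs _).symm
    rw [h2]
    exact (isInvertible_mfderivWithin_extChartAt_symm hz).inverse_apply_eq.2 rfl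
  rw [← mlieBracketWithin_univ, mlieBracketWithin_apply]
  rw [Set.preimage_univ, Set.univ_inter]
  rw [Filter.EventuallyEq.lieBracketWithin_vectorField_eq_of_mem (key a) (key b)
    (extChartAt_target_subset_range x (mem_extChartAt_target x))]
  have h0 : lieBracketWithin ℝ (fun _ : E => (trivializationAt E (TangentSpace I) x ⟨x, a⟩).2)
      (fun _ : E => (trivializationAt E (TangentSpace I) x ⟨x, b⟩).2) (Set.range I)
      (extChartAt I x x) = 0 := by
    simp [lieBracketWithin]
  exact (congrArg _ h0).trans (map_zero _)

variable {E' : Type*} [NormedAddCommGroup E'] [NormedSpace ℝ E']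
  {H' : Type*} [TopologicalSpace H'] {I' : ModelWithCorners ℝ E' H'}
  {M : Type*} [TopologicalSpace M] [ChartedSpace H' M] [IsManifold I' ∞ M]

lemma MDifferentiableAt.mfderiv_extend {φ : M → N} (hφ : ContMDiff I' I ∞ φ) (p : M)
    (w : TangentSpace I' p) : MDifferentiableAt I' I.tangent
      (fun q => (⟨φ q, mfderiv I' I φ q (FiberBundle.extend E' w q)⟩ : TangentBundle I N)) p := by
  have h1 : ContMDiff I'.tangent I.tangent 1 (tangentMap I' I φ) :=
    hφ.contMDiff_tangentMap (m := 1) (by norm_cast)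
  exact ((h1 _).mdifferentiableAt (by simp)).comp p
    (FiberBundle.mdifferentiableAt_extend I' E' w)

variable [I'.Boundaryless]

/-- The extension of `w` is the image of `w` under the derivative of the inverse chart at `p`, and
the trivialization at `φ p` acts as the derivative of the chart there. The chain rule merges these
with dφ. -/
lemma eventually_trivializationAt_mfderiv_extend {φ : M → N} (hφ : ContMDiff I' I ∞ φ) (p : M)
    (w : TangentSpace I' p) :
    ∀ᶠ q in 𝓝 p, (trivializationAt E (TangentSpace I) (φ p)
      ⟨φ q, mfderiv I' I φ q (FiberBundle.extend E' w q)⟩).2 =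
      fderiv ℝ (writtenInExtChartAt I' I p φ) (extChartAt I' p q) w := by
  have key : ∀ᶠ z in 𝓝 (extChartAt I' p p), (trivializationAt E (TangentSpace I) (φ p)
      ⟨φ ((extChartAt I' p).symm z), mfderiv I' I φ ((extChartAt I' p).symm z)
        (FiberBundle.extend E' w ((extChartAt I' p).symm z))⟩).2 =
      fderiv ℝ (writtenInExtChartAt I' I p φ) z w := by
    have hw : (trivializationAt E' (TangentSpace I') p ⟨p, w⟩).2 = w :=
      (tangentBundleCore I' M).coordChange_self (achart H' p) p (mem_chart_source H' p) w
    have hc : ContinuousAt (φ ∘ (extChartAt I' p).symm) (extChartAt I' p p) := by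
      refine ContinuousAt.comp ?_ (continuousAt_extChartAt_symm p)
      exact hφ.continuous.continuousAt
    have hs : (chartAt H (φ p)).source ∈ 𝓝 ((φ ∘ (extChartAt I' p).symm) (extChartAt I' p p)) := by
      simp only [Function.comp_apply, extChartAt_to_inv]
      exact chart_source_mem_nhds H (φ p)
    filter_upwards [extChartAt_target_mem_nhds (I := I') p, hc hs] with z hz hz'
    have hs' : (extChartAt I' p).symm z ∈ (chartAt H' p).source := by
      rw [← extChartAt_source I']; exact (extChartAt I' p).map_target hz
    have h1 := TangentBundle.symmL_trivializationAt (I := I') hs'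
    -- Without boundary the model range is the whole space, so derivatives within it are ordinary
    -- ones.
    rw [(extChartAt I' p).right_inv hz, I'.range_eq_univ, mfderivWithin_univ] at h1
    have h2 : FiberBundle.extend E' w ((extChartAt I' p).symm z) =
        mfderiv 𝓘(ℝ, E') I' (extChartAt I' p).symm z w := by
      have h3 := congrArg (fun L => L w) h1
      refine Eq.trans ?_ h3
      rw [FiberBundle.extend, hw]
      exact ((trivializationAt E' (TangentSpace I') p).symmL_apply hs' _).symm
    rw [h2]
    have hd1 : MDifferentiableAt 𝓘(ℝ, E') I' (extChartAt I' p).symm z := by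
      have := mdifferentiableWithinAt_extChartAt_symm hz
      rwa [I'.range_eq_univ, mdifferentiableWithinAt_univ] at this
    have hd2 : MDifferentiableAt I' I φ ((extChartAt I' p).symm z) :=
      hφ.mdifferentiableAt (by simp)
    have hd3 : MDifferentiableAt I 𝓘(ℝ, E) (extChartAt I (φ p)) (φ ((extChartAt I' p).symm z)) :=
      mdifferentiableAt_extChartAt hz'
    have h4 := hd3.hasMFDerivAt.comp z (hd2.hasMFDerivAt.comp z hd1.hasMFDerivAt)
    have h5 : fderiv ℝ (writtenInExtChartAt I' I p φ) z w =
        mfderiv I 𝓘(ℝ, E) (extChartAt I (φ p)) (φ ((extChartAt I' p).symm z))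
          (mfderiv I' I φ ((extChartAt I' p).symm z)
            (mfderiv 𝓘(ℝ, E') I' (extChartAt I' p).symm z w)) :=
      congrArg (fun L : E' →L[ℝ] E => L w) (mfderiv_eq_fderiv.symm.trans h4.mfderiv)
    have h7 := TangentBundle.continuousLinearMapAt_trivializationAt (I := I) hz'
    refine Eq.trans ?_ h5.symm
    refine Eq.trans ?_ (congrArg (fun L => L (mfderiv I' I φ ((extChartAt I' p).symm z)
            (mfderiv 𝓘(ℝ, E') I' (extChartAt I' p).symm z w))) h7)
    exact congrFun (((trivializationAt E (TangentSpace I) (φ p)).coe_linearMapAt_of_mem (R := ℝ)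
      hz').symm) _
  filter_upwards [(continuousAt_extChartAt (I := I') p).eventually key,
    extChartAt_source_mem_nhds (I := I') p] with q hq hq'
  rwa [(extChartAt I' p).left_inv hq'] at hq

/-- The flat part of the covariant derivative is a Hessian of φ in charts, and hence symmetric. -/
lemma mvfderiv_trivializationAt_mfderiv_extend {φ : M → N} (hφ : ContMDiff I' I ∞ φ) {p : M}
    (v w : TangentSpace I' p) :
    mvfderiv I' (fun q => (trivializationAt E (TangentSpace I) (φ p)
      ⟨φ q, mfderiv I' I φ q (FiberBundle.extend E' w q)⟩).2) p v =
      fderiv ℝ (fderiv ℝ (writtenInExtChartAt I' I p φ)) (extChartAt I' p p) v w := by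
  rw [Filter.EventuallyEq.mvfderiv_eq (eventually_trivializationAt_mfderiv_extend hφ p w)]
  have h3 : ContDiffAt ℝ 2 (writtenInExtChartAt I' I p φ) (extChartAt I' p p) := by
    have := (contMDiffAt_iff.1 (hφ p)).2
    rw [I'.range_eq_univ, contDiffWithinAt_univ] at this
    exact this.of_le (by norm_cast)
  have h4 : DifferentiableAt ℝ (fderiv ℝ (writtenInExtChartAt I' I p φ)) (extChartAt I' p p) :=
    (h3.fderiv_right (m := 1) (by norm_num)).differentiableAt (by simp)
  have h5 : ∀ w : E', HasFDerivAt (fun z => fderiv ℝ (writtenInExtChartAt I' I p φ) z w)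
      ((fderiv ℝ (fderiv ℝ (writtenInExtChartAt I' I p φ)) (extChartAt I' p p)).flip w)
      (extChartAt I' p p) := fun w => by
    simpa only [ContinuousLinearMap.comp_zero, zero_add] using
      h4.hasFDerivAt.clm_apply (hasFDerivAt_const w _)
  replace h5 := h5 w
  have h6 := mvfderiv_comp_eq (I := I') (I' := 𝓘(ℝ, E')) (ψ := extChartAt I' p) (x := p)
    h5.hasMFDerivAt.mdifferentiableAt (mdifferentiableAt_extChartAt (mem_chart_source H' p)) v
  refine h6.trans ?_
  -- A chart has identity derivative at its own centre, in the identification of the tangent space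
  -- with the model space.
  rw [mfderiv_extChartAt_self]
  refine (congrArg (fun L : E' →L[ℝ] E => L v) h5.hasMFDerivAt.mfderiv).trans rfl

variable [FiniteDimensional ℝ E]

/-- Covariant differentiation of coordinate fields along a map is symmetric. -/
lemma covDerivAlong_mfderiv_extend_comm
    {D : CovariantDerivative I E (fun x : N => TangentSpace I x)} (hD : D.torsion = 0)
    {φ : M → N} (hφ : ContMDiff I' I ∞ φ) {p : M} (v w : TangentSpace I' p) :
    covDerivAlong D φ (fun q => mfderiv I' I φ q (FiberBundle.extend E' w q)) p v =
      covDerivAlong D φ (fun q => mfderiv I' I φ q (FiberBundle.extend E' v q)) p w := by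
  -- The connection term is symmetric because the torsion and the bracket of the extensions vanish;
  -- the flat term is symmetric by Schwarz.
  have h1 := D.torsion_apply_eq_extend (mfderiv I' I φ p v) (mfderiv I' I φ p w)
  rw [hD, VectorField.mlieBracket_extend] at h1
  simp only [FiberBundle.extend_apply_self, sub_zero] at h1
  have h2 := sub_eq_zero.1 h1.symm
  have h3 : ContDiffAt ℝ 2 (writtenInExtChartAt I' I p φ) (extChartAt I' p p) := by
    have := (contMDiffAt_iff.1 (hφ p)).2
    rw [I'.range_eq_univ, contDiffWithinAt_univ] at this
    exact this.of_le (by norm_cast)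
  have h4 := h3.isSymmSndFDerivAt (by simp) v w
  simp only [covDerivAlong, mvfderiv_trivializationAt_mfderiv_extend hφ,
    FiberBundle.extend_apply_self]
  rw [h2, h4]

end Coordinate

/-! ### Constant extensions on product manifolds -/

section Extend

variable {E₁ : Type*} [NormedAddCommGroup E₁] [NormedSpace ℝ E₁]
  {H₁ : Type*} [TopologicalSpace H₁] {I₁ : ModelWithCorners ℝ E₁ H₁}
  {M₁ : Type*} [TopologicalSpace M₁] [ChartedSpace H₁ M₁] [IsManifold I₁ ∞ M₁]
  {E₂ : Type*} [NormedAddCommGroup E₂] [NormedSpace ℝ E₂]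
  {H₂ : Type*} [TopologicalSpace H₂] {I₂ : ModelWithCorners ℝ E₂ H₂}
  {M₂ : Type*} [TopologicalSpace M₂] [ChartedSpace H₂ M₂] [IsManifold I₂ ∞ M₂]

lemma TangentBundle.extend_eq_tangentCoordChange {p q : M₁} (hq : q ∈ (chartAt H₁ p).source)
    (v : TangentSpace I₁ p) : FiberBundle.extend E₁ v q = tangentCoordChange I₁ p q q v := by
  have hw : (trivializationAt E₁ (TangentSpace I₁) p ⟨p, v⟩).2 = v :=
    (tangentBundleCore I₁ M₁).coordChange_self (achart H₁ p) p (mem_chart_source H₁ p) v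
  have h1 := TangentBundle.symmL_trivializationAt_eq_core (I := I₁) (𝕜 := ℝ) hq
  rw [FiberBundle.extend, hw]
  refine ((trivializationAt E₁ (TangentSpace I₁) p).symmL_apply (R := ℝ) hq v).symm.trans ?_
  exact congrArg (fun L => L v) h1

lemma TangentBundle.extend_zero_of_mem {p q : M₁} (hq : q ∈ (chartAt H₁ p).source) :
    FiberBundle.extend E₁ (0 : TangentSpace I₁ p) q = (0 : TangentSpace I₁ q) := by
  rw [TangentBundle.extend_eq_tangentCoordChange hq]
  exact map_zero (tangentCoordChange I₁ p q q)

/-- Coordinate changes are derivatives of transition maps, and transition maps of a product are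
products; uniqueness of the derivative on the model range concludes. -/
lemma tangentCoordChange_prod {x y z : M₁ × M₂}
    (hx : z ∈ (extChartAt (I₁.prod I₂) x).source)
    (hy : z ∈ (extChartAt (I₁.prod I₂) y).source) :
    tangentCoordChange (I₁.prod I₂) x y z =
      (tangentCoordChange I₁ x.1 y.1 z.1).prodMap (tangentCoordChange I₂ x.2 y.2 z.2) := by
  have hx' := hx
  have hy' := hy
  rw [extChartAt_prod, PartialEquiv.prod_source] at hx' hy'
  have hr : Set.range (I₁.prod I₂) = Set.range I₁ ×ˢ Set.range I₂ := Set.range_prodMap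
  have h1 := hasFDerivWithinAt_tangentCoordChange (I := I₁) (x := x.1) (y := y.1) (z := z.1)
    ⟨hx'.1, hy'.1⟩
  have h2 := hasFDerivWithinAt_tangentCoordChange (I := I₂) (x := x.2) (y := y.2) (z := z.2)
    ⟨hx'.2, hy'.2⟩
  have hu : UniqueDiffWithinAt ℝ (Set.range (I₁.prod I₂)) (extChartAt (I₁.prod I₂) x z) :=
    (I₁.prod I₂).uniqueDiffOn _ (Set.mem_range_self _)
  have h := hasFDerivWithinAt_tangentCoordChange (I := I₁.prod I₂) (x := x) (y := y) (z := z)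
    ⟨hx, hy⟩
  have h3 := HasFDerivWithinAt.prodMap (s := Set.range I₁ ×ˢ Set.range I₂)
    (extChartAt I₁ x.1 z.1, extChartAt I₂ x.2 z.2)
    (h1.mono (by rintro _ ⟨u, hu, rfl⟩; exact hu.1))
    (h2.mono (by rintro _ ⟨u, hu, rfl⟩; exact hu.2))
  refine hu.eq h ?_
  rw [hr, extChartAt_prod, extChartAt_prod]
  exact h3
/-- Constant extensions of tangent vectors to a product manifold are taken componentwise. -/
lemma TangentBundle.extend_prod {p q : M₁ × M₂} (hq : q ∈ (chartAt (ModelProd H₁ H₂) p).source)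
    (v : TangentSpace (I₁.prod I₂) p) :
    FiberBundle.extend (E₁ × E₂) v q =
      ((FiberBundle.extend E₁ (E := TangentSpace I₁) (x := p.1) v.1 q.1,
        FiberBundle.extend E₂ (E := TangentSpace I₂) (x := p.2) v.2 q.2) : E₁ × E₂) := by
  have hq' := hq
  rw [prodChartedSpace_chartAt] at hq'
  refine (TangentBundle.extend_eq_tangentCoordChange hq v).trans ?_
  refine (congrArg (fun L : E₁ × E₂ →L[ℝ] E₁ × E₂ => L v) (tangentCoordChange_prod
    (by rwa [extChartAt_source]) (mem_extChartAt_source q))).trans ?_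
  exact Prod.ext (TangentBundle.extend_eq_tangentCoordChange (p := p.1) hq'.1 v.1).symm
    (TangentBundle.extend_eq_tangentCoordChange (p := p.2) hq'.2 v.2).symm

lemma TangentBundle.eventually_extend_zero (x : M₁) :
    ∀ᶠ q in 𝓝 x, FiberBundle.extend E₁ (0 : TangentSpace I₁ x) q = (0 : TangentSpace I₁ q) := by
  filter_upwards [chart_source_mem_nhds H₁ x] with q hq
  exact TangentBundle.extend_zero_of_mem hq

lemma SmoothMetric.mdifferentiableAt_inner_extend (g : SmoothMetric I₁ M₁) {p : M₁}
    (v w : TangentSpace I₁ p) : MDifferentiableAt I₁ 𝓘(ℝ)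
      (fun q => g.inner q (FiberBundle.extend E₁ v q) (FiberBundle.extend E₁ w q)) p := by
  have hg := (g.contMDiff p).mdifferentiableAt (by simp)
  have h := MDifferentiableAt.clm_bundle_apply₂ (E₃ := Bundle.Trivial M₁ ℝ) (F₃ := ℝ) (b := id)
    hg (FiberBundle.mdifferentiableAt_extend I₁ E₁ v) (FiberBundle.mdifferentiableAt_extend I₁ E₁ w)
  exact ((mdifferentiableAt_totalSpace _ _).1 h).2

lemma SmoothMetric.inner_eq_zero (g : SmoothMetric I₁ M₁) {p : M₁} {v w : TangentSpace I₁ p}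
    (h : v = 0 ∨ w = 0) : g.inner p v w = 0 := by
  rcases h with rfl | rfl
  · rw [map_zero, zero_apply]
  · rw [map_zero]

end Extend

/-! ### The Koszul formula -/

section Koszul

variable {E : Type*} [NormedAddCommGroup E] [NormedSpace ℝ E] [FiniteDimensional ℝ E]
  {H : Type*} [TopologicalSpace H] {I : ModelWithCorners ℝ E H}
  {N : Type*} [TopologicalSpace N] [ChartedSpace H N] [IsManifold I ∞ N]
  [RiemannianBundle (fun x : N => TangentSpace I x)]
  [IsContMDiffRiemannianBundle I ∞ E (fun x : N => TangentSpace I x)]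
  {E' : Type*} [NormedAddCommGroup E'] [NormedSpace ℝ E']
  {H' : Type*} [TopologicalSpace H'] {I' : ModelWithCorners ℝ E' H'} [I'.Boundaryless]
  {M : Type*} [TopologicalSpace M] [ChartedSpace H' M] [IsManifold I' ∞ M]

/-- The Koszul formula for coordinate fields on a submanifold with the induced metric. -/
lemma IsLeviCivita.koszul_along
    {D : CovariantDerivative I E (fun x : N => TangentSpace I x)} (hD : IsLeviCivita D)
    {g : SmoothMetric I' M} {φ : M → N} (hφ : IsIsometricImmersion (I := I) g φ) {p : M}
    (u v w : TangentSpace I' p) :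
    2 * inner ℝ (covDerivAlong D φ (fun q => mfderiv I' I φ q (FiberBundle.extend E' v q)) p u)
        (mfderiv I' I φ p w) =
      mvfderiv I' (fun q => g.inner q (FiberBundle.extend E' v q) (FiberBundle.extend E' w q)) p u
      + mvfderiv I' (fun q => g.inner q (FiberBundle.extend E' u q) (FiberBundle.extend E' w q)) p v
      - mvfderiv I' (fun q => g.inner q (FiberBundle.extend E' u q) (FiberBundle.extend E' v q)) p w
      := by
  have hm := MDifferentiableAt.mfderiv_extend hφ.smooth p
  have key : ∀ u v w : TangentSpace I' p, mvfderiv I' (fun q =>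
      g.inner q (FiberBundle.extend E' v q) (FiberBundle.extend E' w q)) p u =
      inner ℝ (covDerivAlong D φ (fun q => mfderiv I' I φ q (FiberBundle.extend E' v q)) p u)
        (mfderiv I' I φ p w) +
      inner ℝ (covDerivAlong D φ (fun q => mfderiv I' I φ q (FiberBundle.extend E' w q)) p u)
        (mfderiv I' I φ p v) := by
    intro u v w
    have h := hD.mvfderiv_inner_along (hm v) (hm w) u
    simp only [hφ.isometric, FiberBundle.extend_apply_self] at h
    rw [h, real_inner_comm (covDerivAlong D φ _ p u) (mfderiv I' I φ p v)]
  -- No bracket terms occur for coordinate fields: of the six inner products, symmetry cancels four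
  -- and makes the other two equal.
  have hs := fun v w : TangentSpace I' p => covDerivAlong_mfderiv_extend_comm hD.torsion_free
    hφ.smooth v w
  rw [key u v w, key v u w, key w u v, hs v u, hs w u, hs w v]
  ring

end Koszul

/-! ### The bi-warped metric on coordinate fields -/

section BiWarped

variable {E₁ : Type*} [NormedAddCommGroup E₁] [NormedSpace ℝ E₁]
  {H₁ : Type*} [TopologicalSpace H₁] {I₁ : ModelWithCorners ℝ E₁ H₁}
  {M₁ : Type*} [TopologicalSpace M₁] [ChartedSpace H₁ M₁]
  {E₂ : Type*} [NormedAddCommGroup E₂] [NormedSpace ℝ E₂]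
  {H₂ : Type*} [TopologicalSpace H₂] {I₂ : ModelWithCorners ℝ E₂ H₂}
  {M₂ : Type*} [TopologicalSpace M₂] [ChartedSpace H₂ M₂]
  {E₃ : Type*} [NormedAddCommGroup E₃] [NormedSpace ℝ E₃]
  {H₃ : Type*} [TopologicalSpace H₃] {I₃ : ModelWithCorners ℝ E₃ H₃}
  {M₃ : Type*} [TopologicalSpace M₃] [ChartedSpace H₃ M₃]

lemma mfderiv_fst_fst_apply (p : (M₁ × M₂) × M₃) (v : TangentSpace ((I₁.prod I₂).prod I₃) p) :
    mfderiv ((I₁.prod I₂).prod I₃) I₁ (fun q : (M₁ × M₂) × M₃ => q.1.1) p v = v.1.1 := by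
  have := mfderiv_comp p (mdifferentiableAt_fst (I := I₁) (I' := I₂) (x := p.1))
    (mdifferentiableAt_fst (I := I₁.prod I₂) (I' := I₃) (x := p))
  rw [mfderiv_fst, mfderiv_fst] at this
  exact congrArg (fun L => L v) this

lemma mfderiv_snd_fst_apply (p : (M₁ × M₂) × M₃) (v : TangentSpace ((I₁.prod I₂).prod I₃) p) :
    mfderiv ((I₁.prod I₂).prod I₃) I₂ (fun q : (M₁ × M₂) × M₃ => q.1.2) p v = v.1.2 := by
  have := mfderiv_comp p (mdifferentiableAt_snd (I := I₁) (I' := I₂) (x := p.1))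
    (mdifferentiableAt_fst (I := I₁.prod I₂) (I' := I₃) (x := p))
  rw [mfderiv_fst, mfderiv_snd] at this
  exact congrArg (fun L => L v) this

lemma mfderiv_snd_apply (p : (M₁ × M₂) × M₃) (v : TangentSpace ((I₁.prod I₂).prod I₃) p) :
    mfderiv ((I₁.prod I₂).prod I₃) I₃ (fun q : (M₁ × M₂) × M₃ => q.2) p v = v.2 := by
  have := mfderiv_snd (I := I₁.prod I₂) (I' := I₃) (x := p)
  exact congrArg (fun L => L v) this

lemma mfderiv_slice_fst_apply (x : M₁) (y : M₂) (z : M₃) (a : TangentSpace I₁ x) :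
    mfderiv I₁ ((I₁.prod I₂).prod I₃) (fun x => ((x, y), z)) x a = (((a, 0), 0) : (E₁ × E₂) × E₃) :=
  congrArg (fun L : E₁ →L[ℝ] (E₁ × E₂) × E₃ => L a) (((hasMFDerivAt_id x).prodMk
    (hasMFDerivAt_const y x)).prodMk (hasMFDerivAt_const z x)).mfderiv

lemma mfderiv_slice_snd_apply (x : M₁) (y : M₂) (z : M₃) (b : TangentSpace I₂ y) :
    mfderiv I₂ ((I₁.prod I₂).prod I₃) (fun y => ((x, y), z)) y b = (((0, b), 0) : (E₁ × E₂) × E₃) :=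
  congrArg (fun L : E₂ →L[ℝ] (E₁ × E₂) × E₃ => L b) (((hasMFDerivAt_const x y).prodMk
    (hasMFDerivAt_id y)).prodMk (hasMFDerivAt_const z y)).mfderiv

variable [IsManifold I₁ ∞ M₁] [IsManifold I₂ ∞ M₂] [IsManifold I₃ ∞ M₃]

lemma TangentBundle.eventually_extend_prod_prod (p : (M₁ × M₂) × M₃) :
    ∀ᶠ q in 𝓝 p, ∀ v : TangentSpace ((I₁.prod I₂).prod I₃) p,
      FiberBundle.extend ((E₁ × E₂) × E₃) v q =
        (((FiberBundle.extend E₁ (E := TangentSpace I₁) (x := p.1.1) v.1.1 q.1.1,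
          FiberBundle.extend E₂ (E := TangentSpace I₂) (x := p.1.2) v.1.2 q.1.2),
          FiberBundle.extend E₃ (E := TangentSpace I₃) (x := p.2) v.2 q.2) : (E₁ × E₂) × E₃) := by
  filter_upwards [chart_source_mem_nhds (ModelProd (ModelProd H₁ H₂) H₃) p] with q hq v
  have hq' := hq
  rw [prodChartedSpace_chartAt] at hq'
  refine (TangentBundle.extend_prod hq v).trans ?_
  exact Prod.ext (TangentBundle.extend_prod (p := p.1) hq'.1 v.1) rfl

variable [FiniteDimensional ℝ E₁] [FiniteDimensional ℝ E₂] [FiniteDimensional ℝ E₃]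
  {gT : SmoothMetric I₁ M₁} {gP : SmoothMetric I₂ M₂} {gS : SmoothMetric I₃ M₃} {f₁ f₂ : M₁ → ℝ}
  {hf₁ : ContMDiff I₁ 𝓘(ℝ) ∞ f₁} {hpos₁ : ∀ x, 0 < f₁ x}
  {hf₂ : ContMDiff I₁ 𝓘(ℝ) ∞ f₂} {hpos₂ : ∀ x, 0 < f₂ x}

lemma biWarpedMetric_inner_apply (p : (M₁ × M₂) × M₃)
    (v w : TangentSpace ((I₁.prod I₂).prod I₃) p) :
    (biWarpedMetric gT gP gS f₁ f₂ hf₁ hpos₁ hf₂ hpos₂).inner p v w =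
      gT.inner p.1.1 v.1.1 w.1.1 + f₁ p.1.1 ^ 2 * gP.inner p.1.2 v.1.2 w.1.2
        + f₂ p.1.1 ^ 2 * gS.inner p.2 v.2 w.2 := by
  rw [← mfderiv_fst_fst_apply p v, ← mfderiv_fst_fst_apply p w, ← mfderiv_snd_fst_apply p v,
    ← mfderiv_snd_fst_apply p w, ← mfderiv_snd_apply p v, ← mfderiv_snd_apply p w]
  rfl

lemma biWarpedMetric_inner_eq_zero (p : (M₁ × M₂) × M₃)
    (v w : TangentSpace ((I₁.prod I₂).prod I₃) p) (h1 : v.1.1 = 0 ∨ w.1.1 = 0)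
    (h2 : v.1.2 = 0 ∨ w.1.2 = 0) (h3 : v.2 = 0 ∨ w.2 = 0) :
    (biWarpedMetric gT gP gS f₁ f₂ hf₁ hpos₁ hf₂ hpos₂).inner p v w = 0 := by
  rw [biWarpedMetric_inner_apply, SmoothMetric.inner_eq_zero gT h1,
    SmoothMetric.inner_eq_zero gP h2, SmoothMetric.inner_eq_zero gS h3]
  simp

/-- In the bi-warped metric the inner product of two coordinate fields, near `p`. -/
lemma eventually_biWarpedMetric_inner_extend (p : (M₁ × M₂) × M₃)
    (v w : TangentSpace ((I₁.prod I₂).prod I₃) p) :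
    ∀ᶠ q in 𝓝 p, (biWarpedMetric gT gP gS f₁ f₂ hf₁ hpos₁ hf₂ hpos₂).inner q
        (FiberBundle.extend ((E₁ × E₂) × E₃) v q) (FiberBundle.extend ((E₁ × E₂) × E₃) w q) =
      gT.inner q.1.1 (FiberBundle.extend E₁ (E := TangentSpace I₁) (x := p.1.1) v.1.1 q.1.1)
        (FiberBundle.extend E₁ (E := TangentSpace I₁) (x := p.1.1) w.1.1 q.1.1)
      + f₁ q.1.1 ^ 2 * gP.inner q.1.2
        (FiberBundle.extend E₂ (E := TangentSpace I₂) (x := p.1.2) v.1.2 q.1.2)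
        (FiberBundle.extend E₂ (E := TangentSpace I₂) (x := p.1.2) w.1.2 q.1.2)
      + f₂ q.1.1 ^ 2 * gS.inner q.2
        (FiberBundle.extend E₃ (E := TangentSpace I₃) (x := p.2) v.2 q.2)
        (FiberBundle.extend E₃ (E := TangentSpace I₃) (x := p.2) w.2 q.2) := by
  filter_upwards [TangentBundle.eventually_extend_prod_prod (I₁ := I₁) (I₂ := I₂) (I₃ := I₃) p]
    with q hq
  rw [biWarpedMetric_inner_apply, hq v, hq w]

/-- The inner product of coordinate fields of different factors has zero derivative. -/
lemma mvfderiv_biWarpedMetric_inner_extend_eq_zero (p : (M₁ × M₂) × M₃)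
    (v w : TangentSpace ((I₁.prod I₂).prod I₃) p) (h1 : v.1.1 = 0 ∨ w.1.1 = 0)
    (h2 : v.1.2 = 0 ∨ w.1.2 = 0) (h3 : v.2 = 0 ∨ w.2 = 0) :
    mvfderiv ((I₁.prod I₂).prod I₃) (fun q =>
      (biWarpedMetric gT gP gS f₁ f₂ hf₁ hpos₁ hf₂ hpos₂).inner q
        (FiberBundle.extend ((E₁ × E₂) × E₃) v q) (FiberBundle.extend ((E₁ × E₂) × E₃) w q)) p
      = 0 := by
  apply mvfderiv_eq_zero_of_eventuallyEq_const (c := 0)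
  filter_upwards [eventually_biWarpedMetric_inner_extend p v w,
    (continuous_fst.fst.tendsto p).eventually (TangentBundle.eventually_extend_zero (I₁ := I₁) p.1.1),
    (continuous_fst.snd.tendsto p).eventually (TangentBundle.eventually_extend_zero (I₁ := I₂) p.1.2),
    (continuous_snd.tendsto p).eventually (TangentBundle.eventually_extend_zero (I₁ := I₃) p.2)]
    with q hq z1 z2 z3
  rw [hq]
  have e1 : ∀ {u : TangentSpace I₁ p.1.1}, u = 0 → FiberBundle.extend E₁ u q.1.1 = 0 := by
    rintro _ rfl; exact z1
  have e2 : ∀ {u : TangentSpace I₂ p.1.2}, u = 0 → FiberBundle.extend E₂ u q.1.2 = 0 := by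
    rintro _ rfl; exact z2
  have e3 : ∀ {u : TangentSpace I₃ p.2}, u = 0 → FiberBundle.extend E₃ u q.2 = 0 := by
    rintro _ rfl; exact z3
  rw [SmoothMetric.inner_eq_zero gT (h1.imp e1 e1), SmoothMetric.inner_eq_zero gP (h2.imp e2 e2),
    SmoothMetric.inner_eq_zero gS (h3.imp e3 e3), mul_zero, mul_zero, add_zero, add_zero]

/-- Moving along the first factor leaves the point of `M₂` fixed, so the derivative falls on the
factor `f₁ ^ 2` alone. This is how the differential of `f₁` enters the proof. -/
lemma mvfderiv_biWarpedMetric_inner_extend_snd (x : M₁) (y : M₂) (z : M₃)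
    (a : TangentSpace I₁ x) (b : TangentSpace I₂ y) :
    mvfderiv ((I₁.prod I₂).prod I₃) (fun q =>
      (biWarpedMetric gT gP gS f₁ f₂ hf₁ hpos₁ hf₂ hpos₂).inner q
        (FiberBundle.extend ((E₁ × E₂) × E₃) (E := TangentSpace ((I₁.prod I₂).prod I₃)) (x := ((x, y), z))
          (((0, b), 0) : (E₁ × E₂) × E₃) q)
        (FiberBundle.extend ((E₁ × E₂) × E₃) (E := TangentSpace ((I₁.prod I₂).prod I₃)) (x := ((x, y), z))
          (((0, b), 0) : (E₁ × E₂) × E₃) q)) ((x, y), z) (((a, 0), 0) : (E₁ × E₂) × E₃)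
      = 2 * f₁ x * mvfderiv I₁ f₁ x a * gP.inner y b b := by
  set u : TangentSpace ((I₁.prod I₂).prod I₃) ((x, y), z) := (((0, b), 0) : (E₁ × E₂) × E₃)
  have hm := SmoothMetric.mdifferentiableAt_inner_extend
    (biWarpedMetric gT gP gS f₁ f₂ hf₁ hpos₁ hf₂ hpos₂) u u
  have hψ : MDifferentiableAt I₁ ((I₁.prod I₂).prod I₃) (fun x => ((x, y), z)) x :=
    ((mdifferentiableAt_id (x := x)).prodMk (mdifferentiableAt_const (c := y))).prodMk
      (mdifferentiableAt_const (c := z))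
  -- The derivative in the direction `((a, 0), 0)` is that of the restriction to the slice through
  -- `y` and `z`.
  have hc := mvfderiv_comp_eq (ψ := fun x => ((x, y), z)) (x := x) hm hψ a
  rw [mfderiv_slice_fst_apply] at hc
  rw [← hc]
  have he : (fun x' : M₁ => (biWarpedMetric gT gP gS f₁ f₂ hf₁ hpos₁ hf₂ hpos₂).inner ((x', y), z)
      (FiberBundle.extend ((E₁ × E₂) × E₃) u ((x', y), z))
      (FiberBundle.extend ((E₁ × E₂) × E₃) u ((x', y), z)))
      =ᶠ[𝓝 x] fun x' => f₁ x' ^ 2 * gP.inner y b b := by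
    have h0 := TangentBundle.eventually_extend_zero (I₁ := I₁) x
    have h1 := hψ.continuousAt.eventually (eventually_biWarpedMetric_inner_extend (gT := gT)
      (gP := gP) (gS := gS) (hf₁ := hf₁) (hpos₁ := hpos₁) (hf₂ := hf₂) (hpos₂ := hpos₂) _ u u)
    filter_upwards [h0, h1] with x' h0 h1
    rw [h1]
    have t1 : FiberBundle.extend E₁ (E := TangentSpace I₁) (x := x) u.1.1 x' = 0 := h0
    have t2 : FiberBundle.extend E₂ (E := TangentSpace I₂) (x := y) u.1.2 y = b :=
      FiberBundle.extend_apply_self _ _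
    have t3 : FiberBundle.extend E₃ (E := TangentSpace I₃) (x := z) u.2 z = 0 :=
      FiberBundle.extend_apply_self _ _
    rw [t1, t2, t3]
    simp
  rw [he.mvfderiv_eq]
  have hd : MDifferentiableAt I₁ 𝓘(ℝ) f₁ x := (hf₁ x).mdifferentiableAt (by simp)
  have hd' : MDifferentiableAt I₁ 𝓘(ℝ) (fun x => f₁ x * f₁ x) x := hd.mul hd
  simp only [pow_two]
  rw [mvfderiv_fun_mul hd' mdifferentiableAt_const, mvfderiv_fun_mul hd hd, mvfderiv_const]
  simp only [add_apply, smul_apply, smul_eq_mul]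
  simp
  ring

end BiWarped

/-! ### Tangent spaces of the leaves and the action of `J` -/

section Slices

variable {E₁ : Type*} [NormedAddCommGroup E₁] [NormedSpace ℝ E₁]
  {H₁ : Type*} [TopologicalSpace H₁] {I₁ : ModelWithCorners ℝ E₁ H₁}
  {M₁ : Type*} [TopologicalSpace M₁] [ChartedSpace H₁ M₁]
  {E₂ : Type*} [NormedAddCommGroup E₂] [NormedSpace ℝ E₂]
  {H₂ : Type*} [TopologicalSpace H₂] {I₂ : ModelWithCorners ℝ E₂ H₂}
  {M₂ : Type*} [TopologicalSpace M₂] [ChartedSpace H₂ M₂]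
  {E₃ : Type*} [NormedAddCommGroup E₃] [NormedSpace ℝ E₃]
  {H₃ : Type*} [TopologicalSpace H₃] {I₃ : ModelWithCorners ℝ E₃ H₃}
  {M₃ : Type*} [TopologicalSpace M₃] [ChartedSpace H₃ M₃]
  {E : Type*} [NormedAddCommGroup E] [NormedSpace ℝ E]
  {H : Type*} [TopologicalSpace H] {I : ModelWithCorners ℝ E H}
  {N : Type*} [TopologicalSpace N] [ChartedSpace H N]
  {J : ∀ x : N, TangentSpace I x →L[ℝ] TangentSpace I x}
  {φ : (M₁ × M₂) × M₃ → N}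

lemma mfderiv_comp_slice_fst_apply (hφ : ContMDiff ((I₁.prod I₂).prod I₃) I ∞ φ)
    (x : M₁) (y : M₂) (z : M₃) (a : TangentSpace I₁ x) :
    mfderiv I₁ I (fun x => φ ((x, y), z)) x a =
      mfderiv ((I₁.prod I₂).prod I₃) I φ ((x, y), z) (((a, 0), 0) : (E₁ × E₂) × E₃) := by
  have hψ : MDifferentiableAt I₁ ((I₁.prod I₂).prod I₃) (fun x => ((x, y), z)) x :=
    ((mdifferentiableAt_id (x := x)).prodMk (mdifferentiableAt_const (c := y))).prodMk
      (mdifferentiableAt_const (c := z))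
  have h := mfderiv_comp_apply (f := fun x => ((x, y), z)) x
    ((hφ ((x, y), z)).mdifferentiableAt (by simp)) hψ a
  rw [mfderiv_slice_fst_apply] at h
  exact h

lemma mfderiv_comp_slice_snd_apply (hφ : ContMDiff ((I₁.prod I₂).prod I₃) I ∞ φ)
    (x : M₁) (y : M₂) (z : M₃) (b : TangentSpace I₂ y) :
    mfderiv I₂ I (fun y => φ ((x, y), z)) y b =
      mfderiv ((I₁.prod I₂).prod I₃) I φ ((x, y), z) (((0, b), 0) : (E₁ × E₂) × E₃) := by
  have hψ : MDifferentiableAt I₂ ((I₁.prod I₂).prod I₃) (fun y => ((x, y), z)) y :=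
    ((mdifferentiableAt_const (c := x)).prodMk (mdifferentiableAt_id (x := y))).prodMk
      (mdifferentiableAt_const (c := z))
  have h := mfderiv_comp_apply (f := fun y => ((x, y), z)) y
    ((hφ ((x, y), z)).mdifferentiableAt (by simp)) hψ b
  rw [mfderiv_slice_snd_apply] at h
  exact h

/-- If the leaves tangent to the first factor are holomorphic, their tangent spaces are
`J`-invariant. -/
lemma exists_mfderiv_fst_eq_of_isHolomorphicSubmanifold
    (hφ : ContMDiff ((I₁.prod I₂).prod I₃) I ∞ φ)
    (hT : ∀ y z, IsHolomorphicSubmanifold I₁ J (fun x => φ ((x, y), z)))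
    (p : (M₁ × M₂) × M₃) (v : TangentSpace ((I₁.prod I₂).prod I₃) p) (hv₂ : v.1.2 = 0)
    (hv₃ : v.2 = 0) :
    ∃ w : TangentSpace ((I₁.prod I₂).prod I₃) p, w.1.2 = 0 ∧ w.2 = 0 ∧
      J (φ p) (mfderiv ((I₁.prod I₂).prod I₃) I φ p v) =
        mfderiv ((I₁.prod I₂).prod I₃) I φ p w := by
  obtain ⟨⟨x, y⟩, z⟩ := p
  obtain ⟨⟨a, b⟩, c⟩ := v
  obtain rfl : b = 0 := hv₂
  obtain rfl : c = 0 := hv₃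
  obtain ⟨a', ha'⟩ := (hT y z x).le (Submodule.mem_map_of_mem (LinearMap.mem_range_self _ a))
  refine ⟨(((a', 0), 0) : (E₁ × E₂) × E₃), rfl, rfl, ?_⟩
  rw [← mfderiv_comp_slice_fst_apply hφ x y z a']
  exact (congrArg (J _) (mfderiv_comp_slice_fst_apply hφ x y z a)).symm.trans ha'.symm

variable [RiemannianBundle (fun x : N => TangentSpace I x)]

lemma inner_mfderiv_snd_eq_zero_of_isTotallyRealSubmanifold
    (hφ : ContMDiff ((I₁.prod I₂).prod I₃) I ∞ φ)
    (hP : ∀ x z, IsTotallyRealSubmanifold I₂ J (fun y => φ ((x, y), z)))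
    (p : (M₁ × M₂) × M₃) (v w : TangentSpace ((I₁.prod I₂).prod I₃) p) (hv₁ : v.1.1 = 0)
    (hv₃ : v.2 = 0) (hw₁ : w.1.1 = 0) (hw₃ : w.2 = 0) :
    inner ℝ (J (φ p) (mfderiv ((I₁.prod I₂).prod I₃) I φ p v))
      (mfderiv ((I₁.prod I₂).prod I₃) I φ p w) = 0 := by
  obtain ⟨⟨x, y⟩, z⟩ := p
  obtain ⟨⟨a, b⟩, c⟩ := v
  obtain ⟨⟨a', b'⟩, c'⟩ := w
  obtain rfl : a = 0 := hv₁
  obtain rfl : c = 0 := hv₃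
  obtain rfl : a' = 0 := hw₁
  obtain rfl : c' = 0 := hw₃
  have h := hP x z y (Submodule.mem_map_of_mem (LinearMap.mem_range_self _ b))
  rw [← mfderiv_comp_slice_snd_apply hφ x y z b, ← mfderiv_comp_slice_snd_apply hφ x y z b']
  exact Submodule.inner_left_of_mem_orthogonal (LinearMap.mem_range_self _ b') h

end Slices

/-! ### Vanishing of the differential of `f₁` -/

section Warping

variable {E₁ : Type*} [NormedAddCommGroup E₁] [NormedSpace ℝ E₁] [FiniteDimensional ℝ E₁]
  {H₁ : Type*} [TopologicalSpace H₁] {I₁ : ModelWithCorners ℝ E₁ H₁}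
  {M₁ : Type*} [TopologicalSpace M₁] [ChartedSpace H₁ M₁] [IsManifold I₁ ∞ M₁]
  {E₂ : Type*} [NormedAddCommGroup E₂] [NormedSpace ℝ E₂] [FiniteDimensional ℝ E₂]
  {H₂ : Type*} [TopologicalSpace H₂] {I₂ : ModelWithCorners ℝ E₂ H₂}
  {M₂ : Type*} [TopologicalSpace M₂] [ChartedSpace H₂ M₂] [IsManifold I₂ ∞ M₂]
  {E₃ : Type*} [NormedAddCommGroup E₃] [NormedSpace ℝ E₃] [FiniteDimensional ℝ E₃]
  {H₃ : Type*} [TopologicalSpace H₃] {I₃ : ModelWithCorners ℝ E₃ H₃}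
  {M₃ : Type*} [TopologicalSpace M₃] [ChartedSpace H₃ M₃] [IsManifold I₃ ∞ M₃]
  {E : Type*} [NormedAddCommGroup E] [NormedSpace ℝ E]
  {H : Type*} [TopologicalSpace H] {I : ModelWithCorners ℝ E H}
  {N : Type*} [TopologicalSpace N] [ChartedSpace H N] [IsManifold I ∞ N]
  [RiemannianBundle (fun x : N => TangentSpace I x)]
  {J : ∀ x : N, TangentSpace I x →L[ℝ] TangentSpace I x}

lemma IsAlmostHermitian.inner_apply_left (hJ : IsAlmostHermitian J) (x : N)
    (v w : TangentSpace I x) : inner ℝ (J x v) w = -inner ℝ v (J x w) := by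
  rw [← hJ.isometry x v (J x w), hJ.sq, inner_neg_right, neg_neg]

variable {gT : SmoothMetric I₁ M₁} {gP : SmoothMetric I₂ M₂} {gS : SmoothMetric I₃ M₃}
  {f₁ f₂ : M₁ → ℝ} {hf₁ : ContMDiff I₁ 𝓘(ℝ) ∞ f₁} {hpos₁ : ∀ x, 0 < f₁ x}
  {hf₂ : ContMDiff I₁ 𝓘(ℝ) ∞ f₂} {hpos₂ : ∀ x, 0 < f₂ x}
  {φ : (M₁ × M₂) × M₃ → N}

/-- Moving `J` to the other side keeps that vector in the first factor, which is orthogonal to the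
second. -/
lemma inner_mfderiv_snd_fst_eq_zero (hJ : IsAlmostHermitian J)
    (hφ : IsIsometricImmersion (I := I) (biWarpedMetric gT gP gS f₁ f₂ hf₁ hpos₁ hf₂ hpos₂) φ)
    (hT : ∀ y z, IsHolomorphicSubmanifold I₁ J (fun x => φ ((x, y), z)))
    (p : (M₁ × M₂) × M₃) (v w : TangentSpace ((I₁.prod I₂).prod I₃) p) (hv₁ : v.1.1 = 0)
    (hv₃ : v.2 = 0) (hw₂ : w.1.2 = 0) (hw₃ : w.2 = 0) :
    inner ℝ (J (φ p) (mfderiv ((I₁.prod I₂).prod I₃) I φ p v))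
      (mfderiv ((I₁.prod I₂).prod I₃) I φ p w) = 0 := by
  obtain ⟨w', hw₂', -, hw'⟩ :=
    exists_mfderiv_fst_eq_of_isHolomorphicSubmanifold hφ.smooth hT p w hw₂ hw₃
  rw [hJ.inner_apply_left, hw', hφ.isometric,
    biWarpedMetric_inner_eq_zero p _ _ (.inl hv₁) (.inr hw₂') (.inl hv₃), neg_zero]

/-- Extensions keep their vanishing components near `p`, so the orthogonality of JV and W holds on a
neighbourhood and can be differentiated. -/
lemma mvfderiv_inner_eq_zero (hJ : IsAlmostHermitian J)
    (hφ : IsIsometricImmersion (I := I) (biWarpedMetric gT gP gS f₁ f₂ hf₁ hpos₁ hf₂ hpos₂) φ)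
    (hT : ∀ y z, IsHolomorphicSubmanifold I₁ J (fun x => φ ((x, y), z)))
    (p : (M₁ × M₂) × M₃) (v w : TangentSpace ((I₁.prod I₂).prod I₃) p) (hv₁ : v.1.1 = 0)
    (hv₃ : v.2 = 0) (hw₂ : w.1.2 = 0) (hw₃ : w.2 = 0) :
    mvfderiv ((I₁.prod I₂).prod I₃) (fun q => inner ℝ
      (J (φ q) (mfderiv ((I₁.prod I₂).prod I₃) I φ q (FiberBundle.extend ((E₁ × E₂) × E₃) v q)))
      (mfderiv ((I₁.prod I₂).prod I₃) I φ q (FiberBundle.extend ((E₁ × E₂) × E₃) w q))) p = 0 := by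
  apply mvfderiv_eq_zero_of_eventuallyEq_const (c := 0)
  filter_upwards [TangentBundle.eventually_extend_prod_prod (I₁ := I₁) (I₂ := I₂) (I₃ := I₃) p,
    (continuous_fst.fst.tendsto p).eventually (TangentBundle.eventually_extend_zero (I₁ := I₁) p.1.1),
    (continuous_fst.snd.tendsto p).eventually (TangentBundle.eventually_extend_zero (I₁ := I₂) p.1.2),
    (continuous_snd.tendsto p).eventually (TangentBundle.eventually_extend_zero (I₁ := I₃) p.2)]
    with q hq z1 z2 z3
  have e1 : ∀ {u : TangentSpace I₁ p.1.1}, u = 0 → FiberBundle.extend E₁ u q.1.1 = 0 := by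
    rintro _ rfl; exact z1
  have e2 : ∀ {u : TangentSpace I₂ p.1.2}, u = 0 → FiberBundle.extend E₂ u q.1.2 = 0 := by
    rintro _ rfl; exact z2
  have e3 : ∀ {u : TangentSpace I₃ p.2}, u = 0 → FiberBundle.extend E₃ u q.2 = 0 := by
    rintro _ rfl; exact z3
  exact inner_mfderiv_snd_fst_eq_zero hJ hφ hT q _ _
    ((congrArg (fun u : (E₁ × E₂) × E₃ => u.1.1) (hq v)).trans (e1 hv₁))
    ((congrArg (fun u : (E₁ × E₂) × E₃ => u.2) (hq v)).trans (e3 hv₃))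
    ((congrArg (fun u : (E₁ × E₂) × E₃ => u.1.2) (hq w)).trans (e2 hw₂))
    ((congrArg (fun u : (E₁ × E₂) × E₃ => u.2) (hq w)).trans (e3 hw₃))

variable [FiniteDimensional ℝ E]
  [IsContMDiffRiemannianBundle I ∞ E (fun x : N => TangentSpace I x)]
  [I₁.Boundaryless] [I₂.Boundaryless] [I₃.Boundaryless]
  {D : CovariantDerivative I E (fun x : N => TangentSpace I x)}

/-- The covariant derivative of an `M₂`-field by an `M₁`-field has no component along `M₃`. -/
lemma inner_covDerivAlong_fst_snd_eq_zero (hD : IsLeviCivita D)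
    (hφ : IsIsometricImmersion (I := I) (biWarpedMetric gT gP gS f₁ f₂ hf₁ hpos₁ hf₂ hpos₂) φ)
    (p : (M₁ × M₂) × M₃) (u v w : TangentSpace ((I₁.prod I₂).prod I₃) p)
    (hu₂ : u.1.2 = 0) (hu₃ : u.2 = 0) (hv₁ : v.1.1 = 0) (hv₃ : v.2 = 0) (hw : w.1 = 0) :
    inner ℝ (covDerivAlong D φ (fun q => mfderiv ((I₁.prod I₂).prod I₃) I φ q
      (FiberBundle.extend ((E₁ × E₂) × E₃) v q)) p u) (mfderiv ((I₁.prod I₂).prod I₃) I φ p w)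
      = 0 := by
  have hw₁ : w.1.1 = 0 := congrArg Prod.fst hw
  have hw₂ : w.1.2 = 0 := congrArg Prod.snd hw
  -- The three vectors lie in three different factors, so every term of the formula vanishes.
  have h := hD.koszul_along hφ u v w
  rw [mvfderiv_biWarpedMetric_inner_extend_eq_zero p v w (.inl hv₁) (.inr hw₂) (.inl hv₃),
    mvfderiv_biWarpedMetric_inner_extend_eq_zero p u w (.inr hw₁) (.inl hu₂) (.inl hu₃),
    mvfderiv_biWarpedMetric_inner_extend_eq_zero p u v (.inr hv₁) (.inl hu₂) (.inl hu₃)] at h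
  simpa using h

/-- If `h(u, v) = 0`, the covariant derivative of an `M₂`-field by an `M₁`-field is tangent to
the leaves of `M₁ × M₂`. -/
lemma exists_covDerivAlong_eq_mfderiv (hD : IsLeviCivita D)
    (hφ : IsIsometricImmersion (I := I) (biWarpedMetric gT gP gS f₁ f₂ hf₁ hpos₁ hf₂ hpos₂) φ)
    (p : (M₁ × M₂) × M₃) (u v : TangentSpace ((I₁.prod I₂).prod I₃) p)
    (hu₂ : u.1.2 = 0) (hu₃ : u.2 = 0) (hv₁ : v.1.1 = 0) (hv₃ : v.2 = 0)
    (hh : secondFundamentalForm D φ p u v = 0) :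
    ∃ w : TangentSpace ((I₁.prod I₂).prod I₃) p, w.2 = 0 ∧
      covDerivAlong D φ (fun q => mfderiv ((I₁.prod I₂).prod I₃) I φ q
        (FiberBundle.extend ((E₁ × E₂) × E₃) v q)) p u
        = mfderiv ((I₁.prod I₂).prod I₃) I φ p w := by
  -- A vector with zero normal component lies in the double orthogonal complement, which is the
  -- tangent space itself.
  rw [secondFundamentalForm, Submodule.starProjection_apply_eq_zero_iff,
    Submodule.orthogonal_orthogonal] at hh
  obtain ⟨w, hw⟩ := hh
  refine ⟨w, ?_, hw.symm⟩
  -- Testing against the third component of `w` itself yields `f₂ ^ 2` times its squared length.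
  obtain ⟨s, hs, hs₃⟩ : ∃ s : TangentSpace ((I₁.prod I₂).prod I₃) p, s.1 = 0 ∧ s.2 = w.2 :=
    ⟨(((0, 0), w.2) : (E₁ × E₂) × E₃), rfl, rfl⟩
  have h := inner_covDerivAlong_fst_snd_eq_zero hD hφ p u v s hu₂ hu₃ hv₁ hv₃ hs
  rw [← hw] at h
  have h0 := (hφ.isometric p w s).symm.trans h
  have hs₁ : w.1.1 = 0 ∨ s.1.1 = 0 := .inr (congrArg Prod.fst hs)
  have hs₂ : w.1.2 = 0 ∨ s.1.2 = 0 := .inr (congrArg Prod.snd hs)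
  rw [biWarpedMetric_inner_apply, SmoothMetric.inner_eq_zero gT hs₁,
    SmoothMetric.inner_eq_zero gP hs₂, hs₃, mul_zero, add_zero, zero_add] at h0
  by_contra hne
  exact (mul_pos (pow_pos (hpos₂ p.1.1) 2) (gS.pos p.2 w.2 hne)).ne' h0

/-- On a nearly Kaehler manifold `∇_Z (J Z) = J ∇_Z Z`. -/
lemma IsNearlyKaehler.covDerivAlong_mfderiv_extend_self (hN : IsNearlyKaehler D J)
    {E' : Type*} [NormedAddCommGroup E'] [NormedSpace ℝ E']
    {H' : Type*} [TopologicalSpace H'] {I' : ModelWithCorners ℝ E' H'}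
    {M : Type*} [TopologicalSpace M] [ChartedSpace H' M] [IsManifold I' ∞ M]
    {φ : M → N} (hφ : ContMDiff I' I ∞ φ) (p : M) (v : TangentSpace I' p) :
    covDerivAlong D φ (fun q => J (φ q) (mfderiv I' I φ q (FiberBundle.extend E' v q))) p v =
      J (φ p) (covDerivAlong D φ (fun q => mfderiv I' I φ q (FiberBundle.extend E' v q)) p v) := by
  rw [covDerivAlong_endo D hN.almostHermitian.smooth (MDifferentiableAt.mfderiv_extend hφ p v) v]
  have hX : MDiffAt (T% (FiberBundle.extend E (mfderiv I' I φ p v))) (φ p) :=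
    FiberBundle.mdifferentiableAt_extend I E _
  -- With equal arguments the nearly Kaehler identity reads 2 (∇_X J) X = 0.
  have h := hN.nearly _ _ _ hX hX
  rw [← two_smul ℝ, smul_eq_zero_iff_right two_ne_zero] at h
  rw [FiberBundle.extend_apply_self, h, zero_add]

/-- The differential of the first warping function vanishes if the submanifold is mixed totally
geodesic. -/
theorem mvfderiv_warping_eq_zero (hN : IsNearlyKaehler D J)
    (hφ : IsIsometricImmersion (I := I) (biWarpedMetric gT gP gS f₁ f₂ hf₁ hpos₁ hf₂ hpos₂) φ)
    (hT : ∀ y z, IsHolomorphicSubmanifold I₁ J (fun x => φ ((x, y), z)))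
    (hP : ∀ x z, IsTotallyRealSubmanifold I₂ J (fun y => φ ((x, y), z)))
    (hmixed : ∀ (p : (M₁ × M₂) × M₃) (u v : TangentSpace ((I₁.prod I₂).prod I₃) p),
      u.1.2 = 0 → u.2 = 0 → v.1.1 = 0 → v.2 = 0 → secondFundamentalForm D φ p u v = 0)
    (x : M₁) (y : M₂) (z : M₃) (a : TangentSpace I₁ x) (b : TangentSpace I₂ y) (hb : b ≠ 0) :
    mvfderiv I₁ f₁ x a = 0 := by
  set A : TangentSpace ((I₁.prod I₂).prod I₃) ((x, y), z) := (((a, 0), 0) : (E₁ × E₂) × E₃)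
    with hA
  set Z : TangentSpace ((I₁.prod I₂).prod I₃) ((x, y), z) := (((0, b), 0) : (E₁ × E₂) × E₃)
    with hZ
  have hD := hN.leviCivita
  have hJ := hN.almostHermitian
  -- Reduces to 2⟨∇_Z Z, A⟩ = -A⟨Z, Z⟩.
  have hk := hD.koszul_along hφ Z Z A
  rw [mvfderiv_biWarpedMetric_inner_extend_eq_zero _ Z A (.inl rfl) (.inr rfl) (.inl rfl)] at hk
  have hs := mvfderiv_biWarpedMetric_inner_extend_snd (gT := gT) (gP := gP) (gS := gS)
    (hf₁ := hf₁) (hpos₁ := hpos₁) (hf₂ := hf₂) (hpos₂ := hpos₂) x y z a b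
  obtain ⟨B, hB₂, hB₃, hB⟩ :=
    exists_mfderiv_fst_eq_of_isHolomorphicSubmanifold hφ.smooth hT _ A rfl rfl
  obtain ⟨C, hC, hBC⟩ := exists_covDerivAlong_eq_mfderiv hD hφ _ B Z hB₂ hB₃ rfl rfl
    (hmixed _ B Z hB₂ hB₃ rfl rfl)
  -- Differentiates ⟨JZ, B⟩ = 0 along Z. Since dφ B = J dφ A at the point, the rewriting turns this
  -- into 0 = ⟨∇_Z Z, A⟩ + ⟨JZ, C⟩, where `C` represents ∇_B Z.
  have hm := hD.mvfderiv_inner_along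
    (MDifferentiableAt.endo_along hJ.smooth (MDifferentiableAt.mfderiv_extend hφ.smooth _ Z))
    (MDifferentiableAt.mfderiv_extend hφ.smooth _ B) Z
  rw [mvfderiv_inner_eq_zero hJ hφ hT _ Z B rfl rfl hB₂ hB₃,
    hN.covDerivAlong_mfderiv_extend_self hφ.smooth,
    covDerivAlong_mfderiv_extend_comm hD.torsion_free hφ.smooth Z B, hBC,
    FiberBundle.extend_apply_self, FiberBundle.extend_apply_self, ← hB, hJ.isometry] at hm
  -- `C` splits into parts in the first two factors, and JZ is orthogonal to each.
  obtain ⟨C₁, C₂, hC', h₁₂, h₁₃, h₂₁, h₂₃⟩ : ∃ C₁ C₂ : TangentSpace ((I₁.prod I₂).prod I₃)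
      ((x, y), z), C = C₁ + C₂ ∧ C₁.1.2 = 0 ∧ C₁.2 = 0 ∧ C₂.1.1 = 0 ∧ C₂.2 = 0 :=
    ⟨(((C.1.1, 0), 0) : (E₁ × E₂) × E₃), (((0, C.1.2), 0) : (E₁ × E₂) × E₃),
      Prod.ext (Prod.ext (add_zero _).symm (zero_add _).symm) (hC.trans (add_zero _).symm),
      rfl, rfl, rfl, rfl⟩
  rw [hC', map_add, inner_add_right,
    inner_mfderiv_snd_fst_eq_zero hJ hφ hT _ Z _ rfl rfl h₁₂ h₁₃,
    inner_mfderiv_snd_eq_zero_of_isTotallyRealSubmanifold hφ.smooth hP _ Z _ rfl rfl h₂₁ h₂₃,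
    add_zero, add_zero] at hm
  have h0 : 2 * f₁ x * mvfderiv I₁ f₁ x a * gP.inner y b b = 0 := by
    rw [← hs]
    simp only [zero_apply] at hk hm
    rw [← hm] at hk
    linarith
  have := (hpos₁ x).ne'
  have := (gP.pos y b hb).ne'
  simp_all

end Warping

/-! ### Functions with zero differential -/

section MetricExt

variable {E : Type*} [NormedAddCommGroup E] [NormedSpace ℝ E]
  {H : Type*} [TopologicalSpace H] {I : ModelWithCorners ℝ E H}
  {M : Type*} [TopologicalSpace M] [ChartedSpace H M] [IsManifold I ∞ M]

lemma SmoothMetric.ext_inner {g g' : SmoothMetric I M}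
    (h : ∀ p v w, g.inner p v w = g'.inner p v w) : g = g' := by
  have : g.inner = g'.inner := by
    funext p
    ext v w
    exact h p v w
  cases g
  cases g'
  congr

variable [I.Boundaryless]

lemma isLocallyConstant_of_mvfderiv_eq_zero {f : M → ℝ} (hf : MDifferentiable I 𝓘(ℝ) f)
    (h : ∀ x, mvfderiv I f x = 0) : IsLocallyConstant f := by
  have : IsManifold I 1 M := .of_le (n := ∞) (by norm_cast)
  rw [IsLocallyConstant.iff_eventually_eq]
  intro x
  -- A ball inside the chart target supplies the convexity needed to pass from zero derivative to
  -- constancy.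
  obtain ⟨r, hr, hball⟩ := Metric.mem_nhds_iff.1 (extChartAt_target_mem_nhds (I := I) x)
  have hd : ∀ z ∈ Metric.ball (extChartAt I x x) r,
      HasFDerivAt (fun z => f ((extChartAt I x).symm z)) (0 : E →L[ℝ] ℝ) z := by
    intro z hz
    have h1 := mdifferentiableWithinAt_extChartAt_symm (I := I) (hball hz)
    rw [I.range_eq_univ, mdifferentiableWithinAt_univ] at h1
    have h2 : HasMFDerivAt I 𝓘(ℝ) f ((extChartAt I x).symm z) (0 : E →L[ℝ] ℝ) := by
      have h3 := (hf ((extChartAt I x).symm z)).hasMFDerivAt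
      have h4 : mfderiv I 𝓘(ℝ) f ((extChartAt I x).symm z) = (0 : E →L[ℝ] ℝ) :=
        h ((extChartAt I x).symm z)
      rwa [h4] at h3
    have h5 := (h2.comp z h1.hasMFDerivAt).hasFDerivAt
    exact h5.congr_fderiv (ContinuousLinearMap.zero_comp _)
  have hc : ∀ z ∈ Metric.ball (extChartAt I x x) r,
      f ((extChartAt I x).symm z) = f ((extChartAt I x).symm (extChartAt I x x)) := by
    intro z hz
    refine (convex_ball _ r).is_const_of_fderivWithin_eq_zero (𝕜 := ℝ)
      (f := fun z => f ((extChartAt I x).symm z))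
      (fun z hz => (hd z hz).differentiableAt.differentiableWithinAt) (fun z hz => ?_) hz
      (Metric.mem_ball_self hr)
    exact (hd z hz).hasFDerivWithinAt.fderivWithin (Metric.isOpen_ball.uniqueDiffWithinAt hz)
  filter_upwards [extChartAt_source_mem_nhds (I := I) x,
    (continuousAt_extChartAt (I := I) x).preimage_mem_nhds (Metric.ball_mem_nhds _ hr)]
    with y hy hy'
  have h6 := hc _ hy'
  rwa [(extChartAt I x).left_inv hy, extChartAt_to_inv] at h6

end MetricExt

/-! ### The bi-warped metric with constant `f₁` -/

section MetricEquality

variable {E₁ : Type*} [NormedAddCommGroup E₁] [NormedSpace ℝ E₁] [FiniteDimensional ℝ E₁]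
  {H₁ : Type*} [TopologicalSpace H₁] {I₁ : ModelWithCorners ℝ E₁ H₁}
  {M₁ : Type*} [TopologicalSpace M₁] [ChartedSpace H₁ M₁] [IsManifold I₁ ∞ M₁]
  {E₂ : Type*} [NormedAddCommGroup E₂] [NormedSpace ℝ E₂] [FiniteDimensional ℝ E₂]
  {H₂ : Type*} [TopologicalSpace H₂] {I₂ : ModelWithCorners ℝ E₂ H₂}
  {M₂ : Type*} [TopologicalSpace M₂] [ChartedSpace H₂ M₂] [IsManifold I₂ ∞ M₂]
  {E₃ : Type*} [NormedAddCommGroup E₃] [NormedSpace ℝ E₃] [FiniteDimensional ℝ E₃]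
  {H₃ : Type*} [TopologicalSpace H₃] {I₃ : ModelWithCorners ℝ E₃ H₃}
  {M₃ : Type*} [TopologicalSpace M₃] [ChartedSpace H₃ M₃] [IsManifold I₃ ∞ M₃]

lemma warpedMetric_inner_apply (g₁ : SmoothMetric I₁ M₁) (g₂ : SmoothMetric I₂ M₂) (f : M₁ → ℝ)
    (hf : ContMDiff I₁ 𝓘(ℝ) ∞ f) (hpos : ∀ x, 0 < f x) (p : M₁ × M₂)
    (v w : TangentSpace (I₁.prod I₂) p) :
    (warpedMetric g₁ g₂ f hf hpos).inner p v w =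
      g₁.inner p.1 v.1 w.1 + f p.1 ^ 2 * g₂.inner p.2 v.2 w.2 := by
  have h1 : ∀ v, mfderiv (I₁.prod I₂) I₁ (Prod.fst : M₁ × M₂ → M₁) p v = v.1 := fun v =>
    congrArg (fun L => L v) (mfderiv_fst (I := I₁) (I' := I₂) (x := p))
  have h2 : ∀ v, mfderiv (I₁.prod I₂) I₂ (Prod.snd : M₁ × M₂ → M₂) p v = v.2 := fun v =>
    congrArg (fun L => L v) (mfderiv_snd (I := I₁) (I' := I₂) (x := p))
  rw [← h1 v, ← h1 w, ← h2 v, ← h2 w]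
  rfl

lemma biWarpedMetric_eq_warpedMetric (gT : SmoothMetric I₁ M₁) (gP : SmoothMetric I₂ M₂)
    (gS : SmoothMetric I₃ M₃) {f₁ f₂ : M₁ → ℝ} (hf₁ : ContMDiff I₁ 𝓘(ℝ) ∞ f₁)
    (hpos₁ : ∀ x, 0 < f₁ x) (hf₂ : ContMDiff I₁ 𝓘(ℝ) ∞ f₂) (hpos₂ : ∀ x, 0 < f₂ x) {c : ℝ}
    (hc : 0 < c) (h : ∀ x, f₁ x = c) :
    biWarpedMetric gT gP gS f₁ f₂ hf₁ hpos₁ hf₂ hpos₂ =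
      warpedMetric (productMetric gT (gP.scale c hc)) gS (fun q => f₂ q.1)
        (hf₂.comp contMDiff_fst) (fun q => hpos₂ q.1) := by
  refine SmoothMetric.ext_inner fun p v w => ?_
  rw [biWarpedMetric_inner_apply, warpedMetric_inner_apply, h]
  refine congrArg (· + f₂ p.1.1 ^ 2 * gS.inner p.2 v.2 w.2) ?_
  refine Eq.trans ?_ (warpedMetric_inner_apply _ _ _ _ _ p.1 v.1 w.1).symm
  -- The product metric is the warped product with function 1, and `c ^ 2` is absorbed by `scale`.
  rw [one_pow, one_mul]
  rfl

end MetricEquality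

/-! ### The main theorem -/

theorem theorem3p3
    {ET : Type*} [NormedAddCommGroup ET] [NormedSpace ℝ ET] [FiniteDimensional ℝ ET]
    {MT : Type*} [TopologicalSpace MT] [ChartedSpace ET MT] [IsManifold 𝓘(ℝ, ET) ∞ MT]
    {EP : Type*} [NormedAddCommGroup EP] [NormedSpace ℝ EP] [FiniteDimensional ℝ EP]
    {MP : Type*} [TopologicalSpace MP] [ChartedSpace EP MP] [IsManifold 𝓘(ℝ, EP) ∞ MP]
    {ES : Type*} [NormedAddCommGroup ES] [NormedSpace ℝ ES] [FiniteDimensional ℝ ES]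
    {MS : Type*} [TopologicalSpace MS] [ChartedSpace ES MS] [IsManifold 𝓘(ℝ, ES) ∞ MS]
    [ConnectedSpace MT] [Nonempty MP] [Nontrivial EP] [Nonempty MS]
    -- the nearly Kaehler manifold `(N, g, J)` with its Levi-Civita connection `D`
    {E : Type*} [NormedAddCommGroup E] [NormedSpace ℝ E] [FiniteDimensional ℝ E]
    {N : Type*} [TopologicalSpace N] [ChartedSpace E N] [IsManifold 𝓘(ℝ, E) ∞ N]
    [RiemannianBundle (fun x : N => TangentSpace 𝓘(ℝ, E) x)]
    [IsContMDiffRiemannianBundle 𝓘(ℝ, E) ∞ E (fun x : N => TangentSpace 𝓘(ℝ, E) x)]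
    (D : CovariantDerivative 𝓘(ℝ, E) E (fun x : N => TangentSpace 𝓘(ℝ, E) x))
    (J : ∀ x : N, TangentSpace 𝓘(ℝ, E) x →L[ℝ] TangentSpace 𝓘(ℝ, E) x)
    (hN : IsNearlyKaehler D J)
    -- the bi-warped product `MT ×_{f₁} MP ×_{f₂} MS`
    (gT : SmoothMetric 𝓘(ℝ, ET) MT) (gP : SmoothMetric 𝓘(ℝ, EP) MP)
    (gS : SmoothMetric 𝓘(ℝ, ES) MS) (f₁ f₂ : MT → ℝ)
    (hf₁ : ContMDiff 𝓘(ℝ, ET) 𝓘(ℝ) ∞ f₁) (hpos₁ : ∀ x, 0 < f₁ x)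
    (hf₂ : ContMDiff 𝓘(ℝ, ET) 𝓘(ℝ) ∞ f₂) (hpos₂ : ∀ x, 0 < f₂ x)
    -- as a submanifold of `N`, with holomorphic, totally real and proper slant factors
    (φ : (MT × MP) × MS → N)
    (hφ : IsIsometricImmersion (I := 𝓘(ℝ, E))
      (biWarpedMetric gT gP gS f₁ f₂ hf₁ hpos₁ hf₂ hpos₂) φ)
    (hT : ∀ y z, IsHolomorphicSubmanifold 𝓘(ℝ, ET) J (fun x => φ ((x, y), z)))
    (hP : ∀ x z, IsTotallyRealSubmanifold 𝓘(ℝ, EP) J (fun y => φ ((x, y), z)))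
    (θ : ℝ) (hθ : 0 < θ ∧ θ < Real.pi / 2)
    (hS : ∀ x y, IsSlantSubmanifold 𝓘(ℝ, ES) J (fun z => φ ((x, y), z)) θ)
    -- mixed total geodesy: `h(X, Z) = 0` for `X` tangent to `MT` and `Z` tangent to `MP`
    (hmixed : ∀ p : (MT × MP) × MS,
      ∀ X ∈ tangentImage 𝓘(ℝ, ET) ((𝓘(ℝ, ET).prod 𝓘(ℝ, EP)).prod 𝓘(ℝ, ES))
        (fun x => ((x, p.1.2), p.2)) p.1.1,
      ∀ Z ∈ tangentImage 𝓘(ℝ, EP) ((𝓘(ℝ, ET).prod 𝓘(ℝ, EP)).prod 𝓘(ℝ, ES))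
        (fun y => ((p.1.1, y), p.2)) p.1.2,
      secondFundamentalForm D φ p X Z = 0) :
    ∃ (c : ℝ) (hc : 0 < c), (∀ x, f₁ x = c) ∧
      biWarpedMetric gT gP gS f₁ f₂ hf₁ hpos₁ hf₂ hpos₂ =
        warpedMetric (productMetric gT (gP.scale c hc)) gS (fun q => f₂ q.1)
          (hf₂.comp contMDiff_fst) (fun q => hpos₂ q.1) := by

  obtain ⟨y⟩ := ‹Nonempty MP›
  obtain ⟨z⟩ := ‹Nonempty MS›
  obtain ⟨x₀⟩ : Nonempty MT := inferInstance
  -- One nonzero vector at a single point of `MP` suffices, since `f₁` depends only on the point of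
  -- `MT`.
  obtain ⟨b, hb⟩ := exists_ne (0 : EP)
  -- Tangency to a leaf is recast as the vanishing of the other two components.
  have hmixed' : ∀ (p : (MT × MP) × MS)
      (u v : TangentSpace ((𝓘(ℝ, ET).prod 𝓘(ℝ, EP)).prod 𝓘(ℝ, ES)) p),
      u.1.2 = 0 → u.2 = 0 → v.1.1 = 0 → v.2 = 0 → secondFundamentalForm D φ p u v = 0 := by
    intro p u v hu₂ hu₃ hv₁ hv₃
    refine hmixed p u ⟨u.1.1, ?_⟩ v ⟨v.1.2, ?_⟩
    · exact (mfderiv_slice_fst_apply p.1.1 p.1.2 p.2 u.1.1).trans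
        (Prod.ext (Prod.ext rfl hu₂.symm) hu₃.symm)
    · exact (mfderiv_slice_snd_apply p.1.1 p.1.2 p.2 v.1.2).trans
        (Prod.ext (Prod.ext hv₁.symm rfl) hv₃.symm)
  have hzero : ∀ x, mvfderiv 𝓘(ℝ, ET) f₁ x = 0 := fun x => ContinuousLinearMap.ext fun a =>
    mvfderiv_warping_eq_zero hN hφ hT hP hmixed' x y z a b hb
  have hconst : ∀ x, f₁ x = f₁ x₀ := fun x =>
    (isLocallyConstant_of_mvfderiv_eq_zero (hf₁.mdifferentiable (by simp))
      hzero).apply_eq_of_preconnectedSpace x x₀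
  exact ⟨f₁ x₀, hpos₁ x₀, hconst,
    biWarpedMetric_eq_warpedMetric gT gP gS hf₁ hpos₁ hf₂ hpos₂ (hpos₁ x₀) hconst⟩
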